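/- Let $\theta>0$ (the buyer's value of the good) and $\lambda>0$ (loss aversion). Let $w_+,w_-:[0,1]\to[0,1]$ be reverse S-shaped probability weighting functions: continuous, strictly increasing, $w_\pm(0)=0$, $w_\pm(1)=1$, three times differentiable on $(0,1)$ with $w_\pm'''>0$, and with one-sided derivatives $w_\pm'(0),w_\pm'(1)\in(1,\infty]$. A dynamic pricing process $(\tau,T)$ consists of a random time $\tau\in[0,\infty]$ (when the buyer obtains the good), whose distribution function on $[0,\infty)$ is the sum of an absolutely continuous increasing function and a jump function, and of a deterministic cumulative payment function $T:[0,\infty)\to[0,\infty)$ of the form $T(t)=\int_0^t f(s)\,ds+\sum_i a_i 1_{r_i<t}$ with $f\ge 0$ measurable and countably many $a_i,r_i\ge 0$; hence $T(0)=0$ and $T$ is increasing and left-continuous. Put $T(\infty)=\lim_{t\to\infty}T(t)$. The process is dynamically individually rational (DIR) if for every $s\ge0$ with $P(\tau>s)>0$ $$\theta\, w_+\big(P(\tau<\infty\mid\tau>s)\big)-\lambda\int_0^\infty w_-\big(P(T(\tau)-T(s)>y\mid\tau>s)\big)\,dy\ \ge\ 0 .$$ It is optimal if it satisfies DIR and maximizes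 the expected profit $\int_0^\infty P(T(\tau)>y)\,dy$ among all dynamic pricing processes satisfying DIR. Let $\tau_0$ be exponential, $P(\tau_0>t)=e^{-t}$. The following objects exist and are unique: 1. $p_1\in(0,1)$ with $w_-(p_1)=p_1$; 2. $g_0\in L^1[0,-\log p_1]$ (up to null sets) with $e^{-t}-w_-(e^{-t})-\int_0^t w_-(e^{-t+s})g_0(s)\,ds=0$ for all $t\in[0,-\log p_1]$; it has a version that is continuous on $(0,-\log p_1]$, which is the one used below; 3. $t_0=\min\{t\in(0,-\log p_1] : g_0(t)\le 0\}$ (the minimum is attained); 4. $f\in L^1[0,t_0]$ (up to null sets) with $w_-(e^{-t_0+t})+\int_t^{t_0}w_-(e^{-s+t})f(s)\,ds=1$ for all $t\in[0,t_0]$. Define $$T^*(t)=\frac{\theta}{\lambda}\Big(1_{t>t_0}+\int_0^{\min\{t,t_0\}}f(s)\,ds\Big),\qquad t\ge 0,$$ a flow payment up to time $t_0$ followed by a final lump sum $\theta/\lambda$ at $t_0$. Then $(\tau_0,T^*)$ is an optimal dynamic pricing process. Moreover, a dynamic pricing process $(\tau,T)$ is optimal if and only if $$P(\tau<\infty)=1\quad\text{and}\quad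 P(T(\tau)\le y)=P(T^*(\tau_0)\le y)\ \text{ for all } y\ge 0 .$$ -/

import Mathlib

open MeasureTheory Set Filter Topology
open scoped ENNReal NNReal

noncomputable section

namespace LootBox

/-- A reverse S-shaped probability weighting function on `[0,1]`: a continuous strictly increasing
function with `w 0 = 0`, `w 1 = 1`, three times differentiable in `(0,1)` with `w''' > 0` there, and
whose one-sided derivatives at `0` and at `1` exist, possibly as `+∞`, and exceed `1`.
The values of `w` outside `[0,1]` are irrelevant. -/
structure IsWeighting (w : ℝ → ℝ) : Prop where
  zero : w 0 = 0
  one : w 1 = 1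
  strictMono : StrictMonoOn w (Icc 0 1)
  continuousOn : ContinuousOn w (Icc 0 1)
  differentiable : ∀ n < 3, DifferentiableOn ℝ (iteratedDeriv n w) (Ioo 0 1)
  third_pos : ∀ p ∈ Ioo (0 : ℝ) 1, 0 < iteratedDeriv 3 w p
  deriv_zero : ∃ d : EReal, 1 < d ∧ Tendsto (fun p => (slope w 0 p : EReal)) (𝓝[>] 0) (𝓝 d)
  deriv_one : ∃ d : EReal, 1 < d ∧ Tendsto (fun p => (slope w 1 p : EReal)) (𝓝[<] 1) (𝓝 d)

/-- `T t` is the payment accumulated before (not including) time `t`. It starts at `0`, is increasing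
and left-continuous, and is the sum of flow payments `f` and of countably many lump sums `a i`, paid
at the times `r i` (no singular continuous part). -/
structure IsPaymentFunction (T : ℝ≥0 → ℝ) : Prop where
  zero : T 0 = 0
  mono : Monotone T
  leftCont : ∀ t, ContinuousWithinAt T (Iic t) t
  regular : ∃ (f : ℝ → ℝ≥0) (r a : ℕ → ℝ≥0), Measurable f ∧
    ∀ t : ℝ≥0, ENNReal.ofReal (T t) =
      (∫⁻ s in Icc (0 : ℝ) t, (f s : ℝ≥0∞)) + ∑' i, if r i < t then (a i : ℝ≥0∞) else 0

/-- `ν` is the law of a random time `τ` with values in `[0,∞]`, whose distribution function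
`t ↦ P(τ ≤ t)` on `[0,∞)` is the sum of an absolutely continuous increasing function (with
density `ρ`) and of a jump function (no singular continuous part). -/
structure IsTimeLaw (ν : Measure ℝ≥0∞) : Prop where
  prob : IsProbabilityMeasure ν
  regular : ∃ (ρ : ℝ → ℝ≥0) (r m : ℕ → ℝ≥0), Measurable ρ ∧
    ∀ t : ℝ≥0, ν (Iic (t : ℝ≥0∞)) =
      (∫⁻ s in Icc (0 : ℝ) t, (ρ s : ℝ≥0∞)) + ∑' i, if r i ≤ t then (m i : ℝ≥0∞) else 0

/-- A dynamic pricing process `(τ, T)`; the random time `τ` is given by its law `ν`. -/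
def IsPricingProcess (ν : Measure ℝ≥0∞) (T : ℝ≥0 → ℝ) : Prop :=
  IsTimeLaw ν ∧ IsPaymentFunction T

/-- The total payment `T(τ)` when the good is obtained at time `τ = a`;
a buyer who never obtains it (`a = ∞`) pays `lim_{t → ∞} T t`. -/
def totalPayment (T : ℝ≥0 → ℝ) (a : ℝ≥0∞) : ℝ≥0∞ :=
  if a = ∞ then ⨆ t : ℝ≥0, ENNReal.ofReal (T t) else ENNReal.ofReal (T a.toNNReal)

/-- The law of `τ` conditional on `τ > s`. -/
def condLaw (ν : Measure ℝ≥0∞) (s : ℝ≥0) : Measure ℝ≥0∞ :=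
  ProbabilityTheory.cond ν {a | (s : ℝ≥0∞) < a}

/-- `∫_0^∞ w(P(T(τ) - T(s) > y | τ > s)) dy`, the distorted expectation, conditional on `τ > s`, of
the payment still to be made at time `s`. -/
def perceivedPayment (w : ℝ → ℝ) (ν : Measure ℝ≥0∞) (T : ℝ≥0 → ℝ) (s : ℝ≥0) : ℝ≥0∞ :=
  ∫⁻ y in Ioi (0 : ℝ), ENNReal.ofReal (w ((condLaw ν s).real
    {a | ENNReal.ofReal y < totalPayment T a - ENNReal.ofReal (T s)}))

/-- Dynamic individual rationality: for every time `s` with `P(τ > s) > 0`,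
`θ w₊(P(τ < ∞ | τ > s)) - λ ∫_0^∞ w₋(P(T(τ) - T(s) > y | τ > s)) dy ≥ 0`. -/
def DIR (wp wm : ℝ → ℝ) (θ lam : ℝ) (ν : Measure ℝ≥0∞) (T : ℝ≥0 → ℝ) : Prop :=
  ∀ s : ℝ≥0, 0 < ν {a | (s : ℝ≥0∞) < a} →
    ENNReal.ofReal lam * perceivedPayment wm ν T s ≤
      ENNReal.ofReal (θ * wp ((condLaw ν s).real {a | a < ∞}))

/-- The expected profit `∫_0^∞ P(T(τ) > y) dy`. -/
def profit (ν : Measure ℝ≥0∞) (T : ℝ≥0 → ℝ) : ℝ≥0∞ :=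
  ∫⁻ y in Ioi (0 : ℝ), ν {a | ENNReal.ofReal y < totalPayment T a}

/-- `(τ, T)` maximizes the expected profit among all dynamic pricing processes that satisfy
dynamic individual rationality. -/
def IsOptimal (wp wm : ℝ → ℝ) (θ lam : ℝ) (ν : Measure ℝ≥0∞) (T : ℝ≥0 → ℝ) : Prop :=
  IsPricingProcess ν T ∧ DIR wp wm θ lam ν T ∧
    ∀ (ν' : Measure ℝ≥0∞) (T' : ℝ≥0 → ℝ), IsPricingProcess ν' T' → DIR wp wm θ lam ν' T' →
      profit ν' T' ≤ profit ν T

/-- The law of the exponential time `τ₀`, `P(τ₀ > t) = e^{-t}`. -/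
def expTime : Measure ℝ≥0∞ := (ProbabilityTheory.expMeasure 1).map ENNReal.ofReal

/-- `g` is in `L¹[0,t₁]` and
`e^{-t} - w(e^{-t}) - ∫_0^t w(e^{-t+s}) g(s) ds = 0` for all `t ∈ [0,t₁]`. -/
def IsMultiplier (w : ℝ → ℝ) (t₁ : ℝ) (g : ℝ → ℝ) : Prop :=
  IntegrableOn g (Icc 0 t₁) ∧ ∀ t ∈ Icc (0 : ℝ) t₁,
    Real.exp (-t) - w (Real.exp (-t)) - ∫ s in (0 : ℝ)..t, w (Real.exp (-t + s)) * g s = 0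

/-- `f` is in `L¹[0,t₀]` and
`w(e^{-t₀+t}) + ∫_t^{t₀} w(e^{-s+t}) f(s) ds = 1` for all `t ∈ [0,t₀]`. -/
def IsBindingFlow (w : ℝ → ℝ) (t₀ : ℝ) (f : ℝ → ℝ) : Prop :=
  IntegrableOn f (Icc 0 t₀) ∧ ∀ t ∈ Icc (0 : ℝ) t₀,
    w (Real.exp (-t₀ + t)) + ∫ s in t..t₀, w (Real.exp (-s + t)) * f s = 1

/-- `T*(t) = (θ/λ) (1_{t > t₀} + ∫_0^{min(t,t₀)} f(s) ds)`. -/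
def optimalPayment (θ lam t₀ : ℝ) (f : ℝ → ℝ) (t : ℝ≥0) : ℝ :=
  θ / lam * ((if t₀ < (t : ℝ) then 1 else 0) + ∫ s in (0 : ℝ)..min (t : ℝ) t₀, f s)

end LootBox

end

noncomputable section

namespace LootBox

section

/-! Only the law of the total payment matters, and in the right coordinates the problem is an
infinite-dimensional linear program. Let `G y` be the probability that the total payment exceeds
`y`, and let `μ` be the image of Lebesgue measure on `{y > 0, G y > 0}` under `y ↦ -log (G y)`
(`paymentMeasure`): the payments on an exponential clock. The profit is `∫ e^{-s} dμ(s)`. DIR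
implies, and for almost surely finite `τ` is equivalent to, `load w₋ μ t ≤ θ/λ` for all `t ≥ 0`,
where the load is the integral of `w₋(e^{-(s-t)})` over `s ≥ t` (`load_le_of_dir`,
`dir_of_load_le`).

The dual solution is a unit atom at `0` plus `g₀(t) dt` on `(0, t₀)`. Its shadow cost of a payment
at time `s` equals `e^{-s}` for `s ≤ t₀`, by the equation for `g₀`, and exceeds `e^{-s}` for `s >
t₀` (`lt_shadowCost`). The latter is where `w₋''' > 0` enters: `w₋` lies above its quadratic Hermite
interpolant at `0, q, q`, and integrating this bound against the multipliers leaves an error with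
the sign of `-g₀(t₀) ≥ 0`. Weak duality bounds the profit by `θ/λ` times the total multiplier mass.
The payments `T*` bind on `[0, t₀]` and stop at `t₀`, so they attain the bound.

For uniqueness, complementary slackness (`slackness`) confines an optimal `μ` to `[0, t₀]` and makes
the constraints bind at `0` and almost everywhere on `(0, t₀)`. Then `μ`, and with it `G`, is
determined by inverting the load. If `τ = ∞` had positive probability, the constraint at `0` would
be slack (`load_zero_lt`).

Existence and inversion both come from renewal theory. Write `k(u) = w₋(e^{-u})` and `m = -k'`, with
`m` cut off at `-log p₁` so that its mass is below `1`. The resolvent `R = m + m⋆m + …` satisfies `k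
+ k⋆R = 1`. Hence `R` run backwards from `t₀` is the binding flow `f`. With `e(t) = e^{-t}` and `y =
e + e⋆R` one finds `k⋆(R - y) = e - k`, so `g₀ = R - y`. The density `m` may be unbounded at `0`;
continuity of `R` on `(0, -log p₁]` is obtained by studying `t R(t)`. -/

theorem _root_.StrictConvexOn.lt_max_of_lt_of_lt {s : Set ℝ} {φ : ℝ → ℝ}
    (h : StrictConvexOn ℝ s φ) {a b c : ℝ} (ha : a ∈ s) (hc : c ∈ s) (hab : a < b) (hbc : b < c) :
    φ b < max (φ a) (φ c) := by
  refine h.lt_on_openSegment ha hc (hab.trans hbc).ne ?_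
  rw [openSegment_eq_Ioo (hab.trans hbc)]
  exact ⟨hab, hbc⟩

/-! ### Weighting functions: fixed point, behaviour near 1, Hermite interpolation. -/

namespace IsWeighting

variable {w : ℝ → ℝ}

theorem differentiableOn_Ioo (hw : IsWeighting w) : DifferentiableOn ℝ w (Ioo 0 1) := by
  simpa using hw.differentiable 0 (by norm_num)

theorem hasDerivAt (hw : IsWeighting w) {p : ℝ} (hp : p ∈ Ioo (0 : ℝ) 1) :
    HasDerivAt w (deriv w p) p :=
  ((hw.differentiableOn_Ioo p hp).differentiableAt (isOpen_Ioo.mem_nhds hp)).hasDerivAt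

theorem continuousOn_deriv (hw : IsWeighting w) : ContinuousOn (deriv w) (Ioo 0 1) := by
  have h := hw.differentiable 1 (by norm_num)
  rw [iteratedDeriv_one] at h
  exact h.continuousOn

theorem strictConvexOn_deriv (hw : IsWeighting w) : StrictConvexOn ℝ (Ioo 0 1) (deriv w) := by
  refine strictConvexOn_of_deriv2_pos' (convex_Ioo 0 1) hw.continuousOn_deriv fun p hp => ?_
  have h := hw.third_pos p hp
  rwa [iteratedDeriv_eq_iterate] at h

theorem deriv_nonneg (hw : IsWeighting w) {p : ℝ} (hp : p ∈ Ioo (0 : ℝ) 1) : 0 ≤ deriv w p := by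
  have h := (hw.strictMono.monotoneOn.mono Ioo_subset_Icc_self).derivWithin_nonneg (x := p)
  rwa [derivWithin_of_isOpen isOpen_Ioo hp] at h

theorem nonneg (hw : IsWeighting w) {p : ℝ} (hp : p ∈ Icc (0 : ℝ) 1) : 0 ≤ w p := by
  rw [← hw.zero]; exact hw.strictMono.monotoneOn (by simp) hp hp.1

theorem le_one (hw : IsWeighting w) {p : ℝ} (hp : p ∈ Icc (0 : ℝ) 1) : w p ≤ 1 := by
  rw [← hw.one]; exact hw.strictMono.monotoneOn hp (by simp) hp.2

theorem pos (hw : IsWeighting w) {p : ℝ} (hp : p ∈ Ioc (0 : ℝ) 1) : 0 < w p := by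
  rw [← hw.zero]; exact hw.strictMono (by simp) ⟨hp.1.le, hp.2⟩ hp.1

theorem exists_deriv_eq_slope (hw : IsWeighting w) {a b : ℝ} (ha : 0 ≤ a) (hab : a < b)
    (hb : b ≤ 1) : ∃ c ∈ Ioo a b, deriv w c = (w b - w a) / (b - a) :=
  _root_.exists_deriv_eq_slope w hab (hw.continuousOn.mono (Icc_subset_Icc ha hb))
    (hw.differentiableOn_Ioo.mono (Ioo_subset_Ioo ha hb))

/-- Two interior fixed points together with `0` and `1` give three consecutive chords of slope `1`,
hence three points where the strictly convex `w'` equals `1`. -/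
theorem fixedPoint_unique (hw : IsWeighting w) {p q : ℝ} (hp : p ∈ Ioo (0 : ℝ) 1)
    (hq : q ∈ Ioo (0 : ℝ) 1) (hwp : w p = p) (hwq : w q = q) : p = q := by
  by_contra hne
  wlog hlt : p < q generalizing p q
  · exact this hq hp hwq hwp (Ne.symm hne) (lt_of_le_of_ne (not_lt.mp hlt) (Ne.symm hne))
  obtain ⟨a, ha, ha'⟩ := hw.exists_deriv_eq_slope le_rfl hp.1 hp.2.le
  obtain ⟨b, hb, hb'⟩ := hw.exists_deriv_eq_slope hp.1.le hlt hq.2.le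
  obtain ⟨c, hc, hc'⟩ := hw.exists_deriv_eq_slope hq.1.le hq.2 le_rfl
  rw [hwp, hw.zero, div_self (by linarith [hp.1])] at ha'
  rw [hwp, hwq, div_self (by linarith)] at hb'
  rw [hwq, hw.one, div_self (by linarith [hq.2])] at hc'
  have h := hw.strictConvexOn_deriv.lt_max_of_lt_of_lt (a := a) (b := b) (c := c)
    ⟨ha.1, ha.2.trans hp.2⟩ ⟨hq.1.trans hc.1, hc.2⟩ (ha.2.trans hb.1) (hb.2.trans hc.1)
  rw [ha', hb', hc'] at h
  simp at h

/-- Endpoint slopes above `1` put `w` above the diagonal near `0` and below it near `1`. -/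
theorem exists_fixedPoint (hw : IsWeighting w) : ∃ p ∈ Ioo (0 : ℝ) 1, w p = p := by
  obtain ⟨d, hd, hd'⟩ := hw.deriv_zero
  obtain ⟨e, he, he'⟩ := hw.deriv_one
  have h0 : ∀ᶠ p in 𝓝[>] (0 : ℝ), 1 < slope w 0 p := by
    filter_upwards [hd'.eventually (lt_mem_nhds hd)] with p hp
    exact_mod_cast hp
  have h1 : ∀ᶠ p in 𝓝[<] (1 : ℝ), 1 < slope w 1 p := by
    filter_upwards [he'.eventually (lt_mem_nhds he)] with p hp
    exact_mod_cast hp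
  obtain ⟨a, ha, ha2⟩ := (h0.and (Ioo_mem_nhdsGT (show (0 : ℝ) < 1 / 2 by norm_num))).exists
  obtain ⟨b, hb, hb2⟩ := (h1.and (Ioo_mem_nhdsLT (show (1 / 2 : ℝ) < 1 by norm_num))).exists
  rw [slope_def_field, hw.zero, lt_div_iff₀ (by linarith [ha2.1])] at ha
  rw [slope_def_field, hw.one, lt_div_iff_of_neg (by linarith [hb2.2])] at hb
  have hab : a ≤ b := by linarith [ha2.2, hb2.1]
  have hc : ContinuousOn (fun p => p - w p) (Icc a b) :=
    (continuousOn_id.sub hw.continuousOn).mono (Icc_subset_Icc ha2.1.le hb2.2.le)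
  obtain ⟨p, hp, hp'⟩ := intermediate_value_Icc hab hc (show (0 : ℝ) ∈ Icc _ _ from
    ⟨by linarith, by linarith⟩)
  exact ⟨p, ⟨ha2.1.trans_le hp.1, hp.2.trans_lt hb2.2⟩, by simp only at hp'; linarith⟩

/-- Beyond some point in `(0, 1)` the derivative is increasing and exceeds `1`. -/
theorem exists_monotoneOn_deriv (hw : IsWeighting w) :
    ∃ q ∈ Ioo (0 : ℝ) 1, 1 < deriv w q ∧ MonotoneOn (deriv w) (Ico q 1) := by
  obtain ⟨p, hp, hwp⟩ := hw.exists_fixedPoint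
  -- The chords over `[0, p]` and `[p, 1]` have slope `1`, so the strictly convex `w'` equals `1` at
  -- some `a < b` and must increase, above `1`, to the right of `b`.
  obtain ⟨a, ha, ha'⟩ := hw.exists_deriv_eq_slope le_rfl hp.1 hp.2.le
  obtain ⟨b, hb, hb'⟩ := hw.exists_deriv_eq_slope hp.1.le hp.2 le_rfl
  rw [hwp, hw.zero, div_self (by linarith [hp.1])] at ha'
  rw [hwp, hw.one, div_self (by linarith [hp.2])] at hb'
  have hb0 : 0 < b := hp.1.trans hb.1
  have ham : a ∈ Ioo (0 : ℝ) 1 := ⟨ha.1, ha.2.trans hp.2⟩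
  have key : ∀ x ∈ Ioo b 1, ∀ y ∈ Ioo (0 : ℝ) 1, x < y → deriv w x < deriv w y := by
    intro x hx y hy hxy
    have h1 := hw.strictConvexOn_deriv.lt_max_of_lt_of_lt (b := b) (c := x)
      ham ⟨hb0.trans hx.1, hx.2⟩ (ha.2.trans hb.1) hx.1
    have h2 := hw.strictConvexOn_deriv.lt_max_of_lt_of_lt (b := x)
      ham hy ((ha.2.trans hb.1).trans hx.1) hxy
    rw [ha', hb', lt_max_iff] at h1
    rw [ha', lt_max_iff] at h2
    rcases h1 with h1 | h1
    · exact absurd h1 (lt_irrefl _)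
    · rcases h2 with h2 | h2
      · exact absurd (h1.trans h2) (lt_irrefl _)
      · exact h2
  obtain ⟨q, hq⟩ := exists_between hb.2
  refine ⟨q, ⟨hb0.trans hq.1, hq.2⟩, ?_, ?_⟩
  · have h1 := hw.strictConvexOn_deriv.lt_max_of_lt_of_lt (b := b) (c := q)
      ham ⟨hb0.trans hq.1, hq.2⟩ (ha.2.trans hb.1) hq.1
    rw [ha', hb', lt_max_iff] at h1
    simpa using h1
  · intro x hx y hy hxy
    rcases hxy.eq_or_lt with rfl | hxy
    · exact le_rfl
    · exact (key x ⟨hq.1.trans_le hx.1, hx.2⟩ y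
        ⟨hb0.trans (hq.1.trans_le hy.1), hy.2⟩ hxy).le

/-- Since `w'` increases near `1`, `(1 - p) w'(p)` is at most the increment `1 - w p`. This controls
`w'` near `1` even when the one-sided derivative there is infinite. -/
theorem tendsto_one_sub_mul_deriv (hw : IsWeighting w) :
    Tendsto (fun p => (1 - p) * deriv w p) (𝓝[<] 1) (𝓝 0) := by
  obtain ⟨q, hq, -, hmono⟩ := hw.exists_monotoneOn_deriv
  have hlim : Tendsto (fun p => 1 - w p) (𝓝[<] 1) (𝓝 0) := by
    have h := (hw.continuousOn 1 (by simp)).mono_left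
      (nhdsWithin_le_of_mem (mem_of_superset (Ioo_mem_nhdsLT zero_lt_one) Ioo_subset_Icc_self))
    rw [hw.one] at h
    simpa using h.const_sub 1
  refine tendsto_of_tendsto_of_tendsto_of_le_of_le' tendsto_const_nhds hlim ?_ ?_
  · filter_upwards [Ioo_mem_nhdsLT hq.2] with p hp
    exact mul_nonneg (by linarith [hp.2]) (hw.deriv_nonneg ⟨hq.1.trans hp.1, hp.2⟩)
  · filter_upwards [Ioo_mem_nhdsLT hq.2] with p hp
    obtain ⟨c, hc, hc'⟩ := hw.exists_deriv_eq_slope (hq.1.trans hp.1).le hp.2 le_rfl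
    have h1 : deriv w p ≤ deriv w c :=
      hmono ⟨hp.1.le, hp.2⟩ ⟨(hp.1.trans hc.1).le, hc.2⟩ hc.1.le
    rw [hc', hw.one, le_div_iff₀ (by linarith [hp.2])] at h1
    linarith

/-- The quadratic Hermite interpolant of `w` at `0, q, q` lies strictly below `w` on `(0, q)`. -/
theorem hermite_lt (hw : IsWeighting w) {q x : ℝ} (hq : q ∈ Ioo (0 : ℝ) 1)
    (hx : x ∈ Ioo (0 : ℝ) 1) :
    w q * (2 * x - x ^ 2) + q * deriv w q * (x ^ 2 - x) < w (x * q) := by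
  by_contra! hle
  have hq0 : q ≠ 0 := hq.1.ne'
  -- The quadratic `a z + b z²` matches `w` at `0` and to first order at `q`, so the difference `φ`
  -- has `φ 0 = φ q = φ' q = 0`. If `φ (x q) ≤ 0`, the mean value theorem gives `c < x q < d < q`
  -- with `φ' c ≤ 0 ≤ φ' d`, against strict convexity of `φ'` on `c < d < q`.
  set b := (q * deriv w q - w q) / q ^ 2 with hb
  set a := (2 * w q - q * deriv w q) / q with ha
  let φ : ℝ → ℝ := fun z => w z - (a * z + b * z ^ 2)
  have hφ' : ∀ z ∈ Ioo (0 : ℝ) 1, HasDerivAt φ (deriv w z - (a + b * (2 * z))) z := by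
    intro z hz
    have h : HasDerivAt φ _ z := (hw.hasDerivAt hz).sub
      (((hasDerivAt_id z).const_mul a).add ((hasDerivAt_pow 2 z).const_mul b))
    exact h.congr_deriv (by simp)
  have hφc : ContinuousOn φ (Icc 0 1) := hw.continuousOn.sub (by fun_prop)
  have hconv : StrictConvexOn ℝ (Ioo (0 : ℝ) 1) (fun z => deriv w z - (a + b * (2 * z))) := by
    refine ⟨convex_Ioo 0 1, fun u hu v hv huv s t hs ht hst => ?_⟩
    have h := hw.strictConvexOn_deriv.2 hu hv huv hs ht hst
    simp only [smul_eq_mul] at h ⊢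
    have : a = (s + t) * a := by rw [hst, one_mul]
    nlinarith
  have hφ0 : φ 0 = 0 := by simp [φ, hw.zero]
  have hφq : φ q = 0 := by simp only [φ, ha, hb]; field_simp; ring
  have hφ'q : deriv w q - (a + b * (2 * q)) = 0 := by simp only [ha, hb]; field_simp; ring
  have hxq : x * q ∈ Ioo 0 q := ⟨mul_pos hx.1 hq.1, mul_lt_of_lt_one_left hq.1 hx.2⟩
  have hφp : φ (x * q) ≤ 0 := by
    have : a * (x * q) + b * (x * q) ^ 2
        = w q * (2 * x - x ^ 2) + q * deriv w q * (x ^ 2 - x) := by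
      simp only [ha, hb]; field_simp; ring
    simp only [φ]; linarith
  obtain ⟨c, hc, hc'⟩ := exists_hasDerivAt_eq_slope φ (fun z => deriv w z - (a + b * (2 * z)))
    hxq.1 (hφc.mono (Icc_subset_Icc le_rfl (hxq.2.trans hq.2).le))
    (fun z hz => hφ' z ⟨hz.1, hz.2.trans (hxq.2.trans hq.2)⟩)
  obtain ⟨d, hd, hd'⟩ := exists_hasDerivAt_eq_slope φ (fun z => deriv w z - (a + b * (2 * z)))
    hxq.2 (hφc.mono (Icc_subset_Icc hxq.1.le hq.2.le))
    (fun z hz => hφ' z ⟨hxq.1.trans hz.1, hz.2.trans hq.2⟩)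
  have h := hconv.lt_max_of_lt_of_lt (a := c) (b := d) (c := q)
    ⟨hc.1, hc.2.trans (hxq.2.trans hq.2)⟩ hq (hc.2.trans hd.1) hd.2
  rw [hφ'q] at h
  have h1 : deriv w c - (a + b * (2 * c)) ≤ 0 := by
    rw [hc', hφ0]; exact div_nonpos_of_nonpos_of_nonneg (by linarith) (by linarith [hxq.1])
  have h2 : 0 ≤ deriv w d - (a + b * (2 * d)) := by
    rw [hd', hφq]; exact div_nonneg (by linarith) (by linarith [hxq.2])
  rw [max_eq_right h1] at h
  linarith

end IsWeighting

end

/-! ### Convolution on the half-line and the resolvent of a kernel. -/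

section

section Convolution

variable {f g h m : ℝ → ℝ≥0∞}

theorem lconvolution_add_right (hf : Measurable f) (hg : Measurable g) :
    f ⋆ₗ (g + h) = f ⋆ₗ g + f ⋆ₗ h := by
  ext t
  simp only [lconvolution_def, Pi.add_apply, mul_add]
  exact lintegral_add_left (by fun_prop) _

theorem lconvolution_add_left (hf : Measurable f) (hh : Measurable h) :
    (f + g) ⋆ₗ h = f ⋆ₗ h + g ⋆ₗ h := by
  ext t
  simp only [lconvolution_def, Pi.add_apply, add_mul]
  exact lintegral_add_left (by fun_prop) _

theorem lconvolution_tsum_right (hf : Measurable f) {F : ℕ → ℝ → ℝ≥0∞}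
    (hF : ∀ n, Measurable (F n)) (t : ℝ) :
    (f ⋆ₗ fun s => ∑' n, F n s) t = ∑' n, (f ⋆ₗ F n) t := by
  simp only [lconvolution_def, ← ENNReal.tsum_mul_left]
  exact lintegral_tsum fun n => by fun_prop

theorem lconvolution_const_mul_right (hf : Measurable f) (hg : Measurable g) (c : ℝ≥0∞) (t : ℝ) :
    (f ⋆ₗ fun s => c * g s) t = c * (f ⋆ₗ g) t := by
  simp only [lconvolution_def]
  rw [← lintegral_const_mul _ (by fun_prop)]
  simp only [mul_left_comm]

theorem lintegral_lconvolution (hf : Measurable f) (hg : Measurable g) :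
    ∫⁻ t, (f ⋆ₗ g) t = (∫⁻ t, f t) * ∫⁻ t, g t := by
  simp only [lconvolution_def]
  rw [lintegral_lintegral_swap (by fun_prop)]
  have : ∀ y, ∫⁻ x, f y * g (-y + x) = f y * ∫⁻ x, g x := fun y => by
    rw [lintegral_const_mul _ (by fun_prop), lintegral_add_left_eq_self]
  simp only [this]
  exact lintegral_mul_const _ hf

theorem lconvolution_of_neg (hf : ∀ t < 0, f t = 0) (hg : ∀ t < 0, g t = 0) {t : ℝ} (ht : t < 0) :
    (f ⋆ₗ g) t = 0 := by
  simp only [lconvolution_def]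
  refine (lintegral_congr fun y => ?_).trans lintegral_zero
  rcases lt_or_ge y 0 with hy | hy
  · rw [hf y hy, zero_mul]
  · rw [hg _ (by linarith), mul_zero]

theorem lconvolution_of_nonpos (hf : ∀ t ≤ 0, f t = 0) (hg : ∀ t ≤ 0, g t = 0) {t : ℝ}
    (ht : t ≤ 0) : (f ⋆ₗ g) t = 0 := by
  simp only [lconvolution_def]
  refine (lintegral_congr fun y => ?_).trans lintegral_zero
  rcases le_or_gt y 0 with hy | hy
  · rw [hf y hy, zero_mul]
  · rw [hg _ (by linarith), mul_zero]

theorem lconvolution_eq_setLIntegral (hf : ∀ t < 0, f t = 0) (hg : ∀ t < 0, g t = 0) (t : ℝ) :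
    (f ⋆ₗ g) t = ∫⁻ s in Ioo 0 t, f (t - s) * g s := by
  rw [lconvolution_comm, lconvolution_def, setLIntegral_congr Ioo_ae_eq_Icc,
    ← lintegral_indicator measurableSet_Icc]
  refine lintegral_congr fun y => ?_
  by_cases hy : y ∈ Icc 0 t
  · rw [indicator_of_mem hy, mul_comm, neg_add_eq_sub]
  · rw [indicator_of_notMem hy]
    rw [mem_Icc, not_and_or, not_le, not_le] at hy
    rcases hy with hy | hy
    · rw [hg y hy, zero_mul]
    · rw [hf _ (by linarith), mul_zero]

/-- A convolution of functions on the half-line as an interval integral. -/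
theorem integral_eq_of_lconvolution_eq (hf : Measurable f) (hg : Measurable g)
    (hf0 : ∀ t < 0, f t = 0) (hg0 : ∀ t < 0, g t = 0) {t c : ℝ} (ht : 0 ≤ t) (hc : 0 ≤ c)
    (h : (f ⋆ₗ g) t = ENNReal.ofReal c) {a b : ℝ → ℝ}
    (ha : ∀ s ∈ Ioo 0 t, f (t - s) = ENNReal.ofReal (a s)) (ha0 : ∀ s ∈ Ioo 0 t, 0 ≤ a s)
    (hb : ∀ s ∈ Ioo 0 t, g s = ENNReal.ofReal (b s)) (hb0 : ∀ s ∈ Ioo 0 t, 0 ≤ b s) :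
    IntervalIntegrable (fun s => a s * b s) volume 0 t ∧ ∫ s in (0 : ℝ)..t, a s * b s = c := by
  rw [lconvolution_eq_setLIntegral hf0 hg0] at h
  have hm : Measurable fun s => f (t - s) * g s := by fun_prop
  have hcongr : EqOn (fun s => (f (t - s) * g s).toReal) (fun s => a s * b s) (Ioo 0 t) :=
    fun s hs => by
      simp only [ha s hs, hb s hs, ENNReal.toReal_mul, ENNReal.toReal_ofReal (ha0 s hs),
        ENNReal.toReal_ofReal (hb0 s hs)]
  have hfin : ∫⁻ s in Ioo 0 t, f (t - s) * g s ≠ ∞ := by rw [h]; exact ENNReal.ofReal_ne_top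
  rw [intervalIntegrable_iff_integrableOn_Ioo_of_le ht]
  refine ⟨IntegrableOn.congr_fun (integrable_toReal_of_lintegral_ne_top hm.aemeasurable hfin)
    hcongr measurableSet_Ioo, ?_⟩
  rw [intervalIntegral.integral_of_le ht, integral_Ioc_eq_integral_Ioo,
    ← setIntegral_congr_fun measurableSet_Ioo hcongr,
    integral_toReal hm.aemeasurable (ae_lt_top hm hfin), h, ENNReal.toReal_ofReal hc]

/-- The convolution powers `m, m ⋆ m, m ⋆ m ⋆ m, …`. -/
def convPow (m : ℝ → ℝ≥0∞) : ℕ → ℝ → ℝ≥0∞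
  | 0 => m
  | n + 1 => m ⋆ₗ convPow m n

/-- The resolvent kernel `m + m ⋆ m + m ⋆ m ⋆ m + …`. -/
def resolvent (m : ℝ → ℝ≥0∞) (t : ℝ) : ℝ≥0∞ := ∑' n, convPow m n t

theorem measurable_convPow (hm : Measurable m) (n : ℕ) : Measurable (convPow m n) := by
  induction n with
  | zero => exact hm
  | succ n ih => exact measurable_lconvolution _ hm ih

theorem measurable_resolvent (hm : Measurable m) : Measurable (resolvent m) :=
  Measurable.tsum (measurable_convPow hm)

theorem lintegral_convPow (hm : Measurable m) (n : ℕ) :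
    ∫⁻ t, convPow m n t = (∫⁻ t, m t) ^ (n + 1) := by
  induction n with
  | zero => simp [convPow]
  | succ n ih =>
    rw [convPow, lintegral_lconvolution hm (measurable_convPow hm n), ih, pow_succ' _ (n + 1)]

theorem convPow_of_nonpos (hm : ∀ t ≤ 0, m t = 0) (n : ℕ) {t : ℝ} (ht : t ≤ 0) :
    convPow m n t = 0 := by
  induction n generalizing t with
  | zero => exact hm t ht
  | succ n ih => exact lconvolution_of_nonpos hm (fun s hs => ih hs) ht

theorem resolvent_of_nonpos (hm : ∀ t ≤ 0, m t = 0) {t : ℝ} (ht : t ≤ 0) : resolvent m t = 0 := by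
  simp [resolvent, convPow_of_nonpos hm _ ht]

theorem resolvent_eq (hm : Measurable m) : resolvent m = m + m ⋆ₗ resolvent m := by
  ext t
  rw [Pi.add_apply]
  have h : (m ⋆ₗ resolvent m) t = ∑' n, convPow m (n + 1) t :=
    lconvolution_tsum_right hm (measurable_convPow hm) t
  rw [h, resolvent, tsum_eq_zero_add' ENNReal.summable]
  rfl

theorem lintegral_resolvent_ne_top (hm : Measurable m) (h1 : ∫⁻ t, m t < 1) :
    ∫⁻ t, resolvent m t ≠ ∞ := by
  unfold resolvent
  rw [lintegral_tsum fun n => (measurable_convPow hm n).aemeasurable]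
  simp only [lintegral_convPow hm, pow_succ, ENNReal.tsum_mul_right, ENNReal.tsum_geometric]
  refine ENNReal.mul_ne_top ?_ (h1.trans ENNReal.one_lt_top).ne
  rw [ENNReal.inv_ne_top]
  exact (tsub_pos_of_lt h1).ne'

/-- Multiplication by `t` is a derivation for convolution, because `t = y + (t - y)`. -/
theorem ofReal_mul_lconvolution (hf : Measurable f) (hg : Measurable g)
    (hf0 : ∀ t ≤ 0, f t = 0) (hg0 : ∀ t ≤ 0, g t = 0) (t : ℝ) :
    ENNReal.ofReal t * (f ⋆ₗ g) t =
      ((fun s => ENNReal.ofReal s * f s) ⋆ₗ g) t + (f ⋆ₗ fun s => ENNReal.ofReal s * g s) t := by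
  simp only [lconvolution_def]
  rw [← lintegral_const_mul _ (by fun_prop), ← lintegral_add_left (by fun_prop)]
  refine lintegral_congr fun y => ?_
  rcases le_or_gt y 0 with hy | hy
  · simp [hf0 y hy]
  rcases le_or_gt (-y + t) 0 with hty | hty
  · simp [hg0 _ hty]
  have : ENNReal.ofReal t = ENNReal.ofReal y + ENNReal.ofReal (-y + t) := by
    rw [← ENNReal.ofReal_add hy.le hty.le]; congr 1; ring
  rw [this]
  ring

/-- The power rule for this derivation; `convPow m (n + 1)` has `n + 2` factors. One factor becomes
`t m(t)`, which in the application stays bounded although `m` may not. -/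
theorem ofReal_mul_convPow_succ (hm : Measurable m) (hm0 : ∀ t ≤ 0, m t = 0) (n : ℕ) (t : ℝ) :
    ENNReal.ofReal t * convPow m (n + 1) t =
      (n + 2) * ((fun s => ENNReal.ofReal s * m s) ⋆ₗ convPow m n) t := by
  have hb : Measurable fun s => ENNReal.ofReal s * m s := by fun_prop
  induction n generalizing t with
  | zero =>
    change ENNReal.ofReal t * (m ⋆ₗ m) t = _ * (_ ⋆ₗ m) t
    rw [ofReal_mul_lconvolution hm hm hm0 hm0, lconvolution_comm (f := m)]
    simp only [Nat.cast_zero, zero_add, two_mul]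
  | succ n ih =>
    have hn := measurable_convPow hm n
    rw [convPow, ofReal_mul_lconvolution hm (measurable_convPow hm _) hm0
      (fun s hs => convPow_of_nonpos hm0 _ hs)]
    simp only [ih]
    rw [lconvolution_const_mul_right hm (by fun_prop), lconvolution_assoc hm hb hn,
      lconvolution_comm (f := m), ← lconvolution_assoc hb hm hn]
    change _ + (n + 2) * (_ ⋆ₗ convPow m (n + 1)) t = _
    push_cast
    ring

/-- The weighted sum of convolution powers whose convolution with `t ↦ t * m t` is, up to the first
term, `t ↦ t * resolvent m t`. -/
def weightedResolvent (m : ℝ → ℝ≥0∞) (t : ℝ) : ℝ≥0∞ := ∑' n : ℕ, (n + 2) * convPow m n t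

theorem measurable_weightedResolvent (hm : Measurable m) : Measurable (weightedResolvent m) :=
  Measurable.tsum fun n => (measurable_convPow hm n).const_mul _

theorem weightedResolvent_of_nonpos (hm : ∀ t ≤ 0, m t = 0) {t : ℝ} (ht : t ≤ 0) :
    weightedResolvent m t = 0 := by
  simp [weightedResolvent, convPow_of_nonpos hm _ ht]

theorem ofReal_mul_resolvent (hm : Measurable m) (hm0 : ∀ t ≤ 0, m t = 0) (t : ℝ) :
    ENNReal.ofReal t * resolvent m t = ENNReal.ofReal t * m t +
      ((fun s => ENNReal.ofReal s * m s) ⋆ₗ weightedResolvent m) t := by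
  have hb : Measurable fun s => ENNReal.ofReal s * m s := by fun_prop
  unfold weightedResolvent
  rw [lconvolution_tsum_right hb fun n => (measurable_convPow hm n).const_mul _, resolvent,
    ← ENNReal.tsum_mul_left, tsum_eq_zero_add' ENNReal.summable]
  congr 1
  refine tsum_congr fun n => ?_
  rw [ofReal_mul_convPow_succ hm hm0, lconvolution_const_mul_right hb (measurable_convPow hm n)]

theorem lintegral_weightedResolvent_ne_top (hm : Measurable m) (h1 : ∫⁻ t, m t < 1) :
    ∫⁻ t, weightedResolvent m t ≠ ∞ := by
  unfold weightedResolvent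
  rw [lintegral_tsum fun n => ((measurable_convPow hm n).const_mul _).aemeasurable]
  simp only [lintegral_const_mul _ (measurable_convPow hm _), lintegral_convPow hm]
  lift ∫⁻ t, m t to ℝ≥0 using (h1.trans ENNReal.one_lt_top).ne with ρ
  have hρ : (ρ : ℝ) < 1 := by exact_mod_cast h1
  have hs : Summable fun n : ℕ => ((n : ℝ≥0) + 2) * ρ ^ (n + 1) := by
    rw [← NNReal.summable_coe]
    push_cast
    have h2 := (summable_pow_mul_geometric_of_norm_lt_one 1 (r := (ρ : ℝ)) (by simpa using hρ))
    have h3 := (summable_geometric_of_lt_one ρ.2 hρ).mul_left 2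
    refine ((h2.add h3).mul_left (ρ : ℝ)).congr fun n => ?_
    change (ρ : ℝ) * ((n : ℝ) ^ 1 * (ρ : ℝ) ^ n + 2 * (ρ : ℝ) ^ n) = (n + 2) * (ρ : ℝ) ^ (n + 1)
    ring
  have := ENNReal.tsum_coe_ne_top_iff_summable.2 hs
  push_cast at this
  exact this

/-- The unit step function. -/
def unitStep : ℝ → ℝ≥0∞ := indicator (Ici 0) 1

theorem measurable_unitStep : Measurable unitStep := measurable_one.indicator measurableSet_Ici

theorem unitStep_of_neg {t : ℝ} (ht : t < 0) : unitStep t = 0 :=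
  indicator_of_notMem (not_le.2 ht) _

theorem unitStep_of_nonneg {t : ℝ} (ht : 0 ≤ t) : unitStep t = 1 :=
  indicator_of_mem (mem_Ici.2 ht) _

theorem unitStep_lconvolution (hf : ∀ t < 0, f t = 0) (t : ℝ) :
    (unitStep ⋆ₗ f) t = ∫⁻ s in Ioo 0 t, f s := by
  rw [lconvolution_eq_setLIntegral (fun _ => unitStep_of_neg) hf]
  refine setLIntegral_congr_fun measurableSet_Ioo fun s hs => ?_
  rw [unitStep_of_nonneg (by linarith [hs.2]), one_mul]

/-- A kernel `k = 1 - 1 ⋆ m` has the resolvent of `m` as its renewal density. -/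
theorem kernel_add_lconvolution_resolvent {k : ℝ → ℝ≥0∞} (hm : Measurable m) (hk : Measurable k)
    (hm0 : ∀ t ≤ 0, m t = 0) (h1 : ∫⁻ t, m t < 1) (hkm : k + unitStep ⋆ₗ m = unitStep) :
    k + k ⋆ₗ resolvent m = unitStep := by
  have hR := measurable_resolvent hm
  have hu := measurable_unitStep
  rw [← hkm]
  congr 1
  -- With `R` the resolvent, `k⋆R` and `1⋆m` have the same sum with `1⋆(m⋆R)`, namely `1⋆R`. That
  -- term can be cancelled because it is at most `∫ R < ∞`.
  have e1 : k ⋆ₗ resolvent m + unitStep ⋆ₗ (m ⋆ₗ resolvent m) = unitStep ⋆ₗ resolvent m := by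
    rw [lconvolution_assoc hu hm hR,
      ← lconvolution_add_left hk hR, hkm]
  have e2 : unitStep ⋆ₗ resolvent m = unitStep ⋆ₗ m + unitStep ⋆ₗ (m ⋆ₗ resolvent m) := by
    conv_lhs => rw [resolvent_eq hm]
    rw [lconvolution_add_right hu hm]
  ext t
  have e3 := congrFun (e1.trans e2) t
  simp only [Pi.add_apply] at e3
  refine (ENNReal.add_left_inj ?_).1 e3
  refine ne_top_of_le_ne_top (lintegral_resolvent_ne_top hm h1) ?_
  rw [unitStep_lconvolution (fun s hs => lconvolution_of_nonpos hm0
    (fun _ => resolvent_of_nonpos hm0) hs.le)]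
  refine (setLIntegral_le_lintegral _ _).trans (lintegral_mono fun s => ?_)
  conv_rhs => rw [resolvent_eq hm]
  exact le_add_self

end Convolution

end

/-! ### Renewal theory for the survival function `w(e^{-u})`, and the multiplier. -/

section

theorem exp_neg_mem_Ioo {t : ℝ} (ht : 0 < t) : Real.exp (-t) ∈ Ioo (0 : ℝ) 1 :=
  ⟨Real.exp_pos _, by rw [Real.exp_lt_one_iff]; linarith⟩

theorem exp_neg_mem_Ioc {t : ℝ} (ht : 0 ≤ t) : Real.exp (-t) ∈ Ioc (0 : ℝ) 1 :=
  ⟨Real.exp_pos _, by rw [Real.exp_le_one_iff]; linarith⟩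

theorem exp_neg_mem_Icc {t : ℝ} (ht : 0 ≤ t) : Real.exp (-t) ∈ Icc (0 : ℝ) 1 :=
  Ioc_subset_Icc_self (exp_neg_mem_Ioc ht)

/-- The density at `u ∈ (0, T]` of the time whose survival function is `u ↦ w (exp (-u))`. -/
def density (w : ℝ → ℝ) (T : ℝ) : ℝ → ℝ≥0∞ :=
  indicator (Ioc 0 T) fun u => ENNReal.ofReal (Real.exp (-u) * deriv w (Real.exp (-u)))

/-- The function `u ↦ w (exp (-u))` on `[0, T]`, extended by `0` to the left and by a constant to
the right. -/
def survival (w : ℝ → ℝ) (T : ℝ) : ℝ → ℝ≥0∞ :=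
  indicator (Ici 0) fun u => ENNReal.ofReal (w (Real.exp (-(max 0 (min u T)))))

/-- The function `t ↦ exp (-t)` on the half-line. -/
def expStep : ℝ → ℝ≥0∞ := indicator (Ici 0) fun t => ENNReal.ofReal (Real.exp (-t))

/-- The renewal density of the distribution with density `density w T`. -/
def renewal (w : ℝ → ℝ) (T : ℝ) (t : ℝ) : ℝ := (resolvent (density w T) t).toReal

/-- The solution `y` of `y' = -y + renewal w T`, `y 0 = 1`. -/
def renewalAverage (w : ℝ → ℝ) (T : ℝ) (t : ℝ) : ℝ :=
  Real.exp (-t) * (1 + ∫ s in (0 : ℝ)..t, Real.exp s * renewal w T s)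

/-- The multiplier of the dynamic individual rationality constraints. -/
def multiplier (w : ℝ → ℝ) (T : ℝ) (t : ℝ) : ℝ := renewal w T t - renewalAverage w T t

variable {w : ℝ → ℝ} {T : ℝ}

theorem measurable_density : Measurable (density w T) := by
  have := measurable_deriv w
  exact Measurable.indicator (by fun_prop) measurableSet_Ioc

theorem density_of_nonpos {t : ℝ} (ht : t ≤ 0) : density w T t = 0 :=
  indicator_of_notMem (fun h => not_lt.2 ht h.1) _

theorem density_of_mem {t : ℝ} (ht : t ∈ Ioc 0 T) :
    density w T t = ENNReal.ofReal (Real.exp (-t) * deriv w (Real.exp (-t))) :=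
  indicator_of_mem ht _

theorem measurable_expStep : Measurable expStep :=
  Measurable.indicator (by fun_prop) measurableSet_Ici

theorem expStep_of_neg {t : ℝ} (ht : t < 0) : expStep t = 0 :=
  indicator_of_notMem (not_le.2 ht) _

theorem expStep_of_nonneg {t : ℝ} (ht : 0 ≤ t) : expStep t = ENNReal.ofReal (Real.exp (-t)) :=
  indicator_of_mem (mem_Ici.2 ht) _

theorem IsWeighting.continuous_comp_exp (hw : IsWeighting w) :
    Continuous fun u => w (Real.exp (-(max 0 (min u T)))) :=
  hw.continuousOn.comp_continuous (by fun_prop) fun _ => exp_neg_mem_Icc (le_max_left _ _)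

theorem IsWeighting.measurable_survival (hw : IsWeighting w) : Measurable (survival w T) :=
  (ENNReal.measurable_ofReal.comp hw.continuous_comp_exp.measurable).indicator measurableSet_Ici

theorem survival_of_neg {t : ℝ} (ht : t < 0) : survival w T t = 0 :=
  indicator_of_notMem (not_le.2 ht) _

theorem survival_of_mem {t : ℝ} (ht : t ∈ Icc 0 T) :
    survival w T t = ENNReal.ofReal (w (Real.exp (-t))) := by
  rw [survival, indicator_of_mem (mem_Ici.2 ht.1), min_eq_left ht.2, max_eq_right ht.1]

theorem IsWeighting.density_nonneg (hw : IsWeighting w) {u : ℝ} (hu : 0 < u) :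
    0 ≤ Real.exp (-u) * deriv w (Real.exp (-u)) :=
  mul_nonneg (Real.exp_pos _).le (hw.deriv_nonneg (exp_neg_mem_Ioo hu))

theorem IsWeighting.lintegral_density (hw : IsWeighting w) {u : ℝ} (hu : 0 ≤ u) :
    ∫⁻ s in Ioc 0 u, ENNReal.ofReal (Real.exp (-s) * deriv w (Real.exp (-s))) =
      ENNReal.ofReal (1 - w (Real.exp (-u))) := by
  have hc : ContinuousOn (fun s => -w (Real.exp (-s))) (Icc 0 u) :=
    (hw.continuousOn.comp (by fun_prop) fun s hs => exp_neg_mem_Icc hs.1).neg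
  have hd : ∀ s ∈ Ioo 0 u, HasDerivAt (fun s => -w (Real.exp (-s)))
      (Real.exp (-s) * deriv w (Real.exp (-s))) s := by
    intro s hs
    have h := ((hw.hasDerivAt (exp_neg_mem_Ioo hs.1)).comp s (hasDerivAt_neg s).exp).neg
    exact h.congr_deriv (by ring)
  have hi := intervalIntegral.integrableOn_deriv_of_nonneg hc hd
    fun s hs => hw.density_nonneg hs.1
  rw [← ofReal_integral_eq_lintegral_ofReal hi, ← intervalIntegral.integral_of_le hu,
    intervalIntegral.integral_eq_sub_of_hasDerivAt_of_le hu hc hd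
      ((intervalIntegrable_iff_integrableOn_Ioc_of_le hu).2 hi)]
  · simp [hw.one]; ring_nf
  · filter_upwards [ae_restrict_mem measurableSet_Ioc] with s hs
    exact hw.density_nonneg hs.1

/-- The reason for truncating at `T`: the remaining mass `w(e^{-T}) > 0` makes the geometric series
of convolution powers converge in `L¹`. -/
theorem IsWeighting.lintegral_density_lt_one (hw : IsWeighting w) (hT : 0 < T) :
    ∫⁻ s, density w T s < 1 := by
  rw [density, lintegral_indicator measurableSet_Ioc, hw.lintegral_density hT.le,
    ENNReal.ofReal_lt_one]
  linarith [hw.pos (exp_neg_mem_Ioc hT.le)]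

theorem IsWeighting.survival_add (hw : IsWeighting w) (hT : 0 < T) :
    survival w T + unitStep ⋆ₗ density w T = unitStep := by
  ext t
  rw [Pi.add_apply, unitStep_lconvolution fun s hs => density_of_nonpos hs.le]
  rcases lt_or_ge t 0 with ht | ht
  · rw [survival_of_neg ht, unitStep_of_neg ht, Ioo_eq_empty (by linarith)]; simp
  have hm : 0 ≤ min t T := le_min ht hT.le
  rw [unitStep_of_nonneg ht, setLIntegral_congr Ioo_ae_eq_Ioc, density,
    setLIntegral_indicator measurableSet_Ioc, Ioc_inter_Ioc, max_self, min_comm T t,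
    hw.lintegral_density hm, survival, indicator_of_mem (mem_Ici.2 ht), max_eq_right hm,
    ← ENNReal.ofReal_add (hw.nonneg (exp_neg_mem_Icc hm))]
  · simp
  · linarith [hw.le_one (exp_neg_mem_Icc hm)]

theorem IsWeighting.survival_add_renewal (hw : IsWeighting w) (hT : 0 < T) :
    survival w T + survival w T ⋆ₗ resolvent (density w T) = unitStep :=
  kernel_add_lconvolution_resolvent measurable_density hw.measurable_survival
    (fun _ => density_of_nonpos) (hw.lintegral_density_lt_one hT) (hw.survival_add hT)

/-- `u ↦ u * exp (-u) * w' (exp (-u))` is continuous up to `u = 0`. -/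
theorem IsWeighting.continuous_mul_density (hw : IsWeighting w) (hT : 0 < T) :
    Continuous fun u => max 0 (min u T) *
      (Real.exp (-(max 0 (min u T))) * deriv w (Real.exp (-(max 0 (min u T))))) := by
  have h : ContinuousOn (fun u => u * (Real.exp (-u) * deriv w (Real.exp (-u)))) (Icc 0 T) := by
    intro u hu
    rcases hu.1.eq_or_lt with rfl | hu0
    · have hexp : Tendsto (fun u : ℝ => Real.exp (-u)) (𝓝[>] 0) (𝓝[<] 1) := by
        refine tendsto_nhdsWithin_iff.2 ⟨?_, ?_⟩
        · have : Continuous fun u : ℝ => Real.exp (-u) := by fun_prop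
          simpa using (this.tendsto 0).mono_left nhdsWithin_le_nhds
        · filter_upwards [self_mem_nhdsWithin] with u hu using (exp_neg_mem_Ioo hu).2
      have hlim : Tendsto (fun u => u * (Real.exp (-u) * deriv w (Real.exp (-u))))
          (𝓝[>] 0) (𝓝 0) := by
        -- With `p = e^{-u}`, the inequality `u e^{-u} ≤ 1 - e^{-u}` bounds the function by `(1 - p)
        -- w'(p)`.
        refine tendsto_of_tendsto_of_tendsto_of_le_of_le' tendsto_const_nhds
          (hw.tendsto_one_sub_mul_deriv.comp hexp) ?_ ?_
        · filter_upwards [self_mem_nhdsWithin] with u hu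
          exact mul_nonneg (le_of_lt hu) (hw.density_nonneg hu)
        · filter_upwards [self_mem_nhdsWithin] with u hu
          rw [← mul_assoc]
          refine mul_le_mul_of_nonneg_right ?_ (hw.deriv_nonneg (exp_neg_mem_Ioo hu))
          have h1 := Real.add_one_le_exp u
          have h2 : Real.exp u * Real.exp (-u) = 1 := by rw [← Real.exp_add]; simp
          nlinarith [Real.exp_pos (-u)]
      have h2 : ContinuousWithinAt (fun u => u * (Real.exp (-u) * deriv w (Real.exp (-u))))
          (Ici 0) 0 := by
        rw [← Ioi_insert, continuousWithinAt_insert_self]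
        simpa [ContinuousWithinAt] using hlim
      exact h2.mono Icc_subset_Ici_self
    · refine ContinuousAt.continuousWithinAt ?_
      have hm := exp_neg_mem_Ioo hu0
      have hd : ContinuousAt (fun u => deriv w (Real.exp (-u))) u :=
        ContinuousAt.comp (f := fun u => Real.exp (-u))
          ((hw.continuousOn_deriv _ hm).continuousAt (isOpen_Ioo.mem_nhds hm)) (by fun_prop)
      fun_prop
  exact h.comp_continuous (by fun_prop) fun u => ⟨le_max_left _ _, max_le hT.le (min_le_right _ _)⟩

/-- The function `b(t) = t m(t)` extends to a bounded continuous function and the weighted resolvent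
`v` is integrable, so `t R(t) = b + b⋆v` is continuous. This also shows that `R` is finite at every
point of `(0, T]`, not just almost everywhere. -/
theorem IsWeighting.exists_continuous_ofReal_mul_resolvent (hw : IsWeighting w) (hT : 0 < T) :
    ∃ c : ℝ → ℝ, Continuous c ∧ ∀ t ∈ Ioc 0 T,
      ENNReal.ofReal t * resolvent (density w T) t = ENNReal.ofReal (c t) := by
  set b : ℝ → ℝ := fun u => max 0 (min u T) *
      (Real.exp (-(max 0 (min u T))) * deriv w (Real.exp (-(max 0 (min u T))))) with hb
  have hbc : Continuous b := hw.continuous_mul_density hT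
  have hb0 : ∀ u, 0 ≤ b u := by
    intro u
    rcases (le_max_left 0 (min u T)).eq_or_lt with h | h
    · simp only [hb, ← h, zero_mul, le_refl]
    · exact mul_nonneg h.le (hw.density_nonneg h)
  have hbm : ∀ u ≤ T, ENNReal.ofReal u * density w T u = ENNReal.ofReal (b u) := by
    intro u hu
    rcases le_or_gt u 0 with h | h
    · simp only [density_of_nonpos h, hb, min_eq_left hu, max_eq_left h, mul_zero, zero_mul,
        ENNReal.ofReal_zero]
    · simp only [density_of_mem (w := w) ⟨h, hu⟩, hb, min_eq_left hu, max_eq_right h.le]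
      rw [ENNReal.ofReal_mul h.le]
  obtain ⟨C, hC⟩ : ∃ C, ∀ u, b u ≤ C := by
    obtain ⟨C, hC⟩ := (isCompact_Icc (a := (0 : ℝ)) (b := T)).bddAbove_image hbc.continuousOn
    refine ⟨C, fun u => ?_⟩
    have : b u = b (max 0 (min u T)) := by
      simp only [hb]
      rw [min_eq_left (max_le hT.le (min_le_right u T)), max_eq_right (le_max_left 0 (min u T))]
    rw [this]
    exact hC (mem_image_of_mem _ ⟨le_max_left _ _, max_le hT.le (min_le_right _ _)⟩)
  have hm := measurable_density (w := w) (T := T)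
  set v := weightedResolvent (density w T) with hv
  have hvm : Measurable v := measurable_weightedResolvent hm
  have hvf := lintegral_weightedResolvent_ne_top hm (hw.lintegral_density_lt_one hT)
  have hvi : Integrable fun y => (v y).toReal :=
    integrable_toReal_of_lintegral_ne_top hvm.aemeasurable hvf
  refine ⟨fun t => b t + ∫ y, (v y).toReal * b (-y + t), hbc.add ?_, fun t ht => ?_⟩
  · refine continuous_of_dominated (bound := fun y => (v y).toReal * C) (fun t => ?_)
      (fun t => ae_of_all _ fun y => ?_) (hvi.mul_const C) (ae_of_all _ fun y => by fun_prop)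
    · exact (hvm.ennreal_toReal.mul (by fun_prop)).aestronglyMeasurable
    · rw [Real.norm_of_nonneg (mul_nonneg ENNReal.toReal_nonneg (hb0 _))]
      exact mul_le_mul_of_nonneg_left (hC _) ENNReal.toReal_nonneg
  · have hnn : ∀ y, 0 ≤ (v y).toReal * b (-y + t) :=
      fun y => mul_nonneg ENNReal.toReal_nonneg (hb0 _)
    rw [ofReal_mul_resolvent hm fun _ => density_of_nonpos, hbm t ht.2,
      ENNReal.ofReal_add (hb0 t) (integral_nonneg hnn), lconvolution_comm, lconvolution_def,
      ofReal_integral_eq_lintegral_ofReal _ (ae_of_all _ hnn)]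
    · congr 1
      refine lintegral_congr_ae ?_
      filter_upwards [ae_lt_top hvm hvf] with y hy
      rw [ENNReal.ofReal_mul ENNReal.toReal_nonneg, ENNReal.ofReal_toReal hy.ne]
      rcases le_or_gt y 0 with h | h
      · simp [hv, weightedResolvent_of_nonpos (fun _ => density_of_nonpos) h]
      · rw [hbm _ (by linarith [ht.2])]
    · refine (hvi.mul_const C).mono' (hvm.ennreal_toReal.mul (by fun_prop)).aestronglyMeasurable
        (ae_of_all _ fun y => ?_)
      rw [Real.norm_of_nonneg (hnn y)]
      exact mul_le_mul_of_nonneg_left (hC _) ENNReal.toReal_nonneg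

theorem measurable_renewal : Measurable (renewal w T) :=
  (measurable_resolvent measurable_density).ennreal_toReal

theorem renewal_nonneg (t : ℝ) : 0 ≤ renewal w T t := ENNReal.toReal_nonneg

theorem IsWeighting.integrable_renewal (hw : IsWeighting w) (hT : 0 < T) :
    Integrable (renewal w T) :=
  integrable_toReal_of_lintegral_ne_top (measurable_resolvent measurable_density).aemeasurable
    (lintegral_resolvent_ne_top measurable_density (hw.lintegral_density_lt_one hT))

theorem IsWeighting.resolvent_eq_ofReal (hw : IsWeighting w) (hT : 0 < T) {t : ℝ} (ht : t ≤ T) :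
    resolvent (density w T) t = ENNReal.ofReal (renewal w T t) := by
  rcases le_or_gt t 0 with h | h
  · simp [renewal, resolvent_of_nonpos (fun _ => density_of_nonpos) h]
  · obtain ⟨c, -, hc⟩ := hw.exists_continuous_ofReal_mul_resolvent hT
    refine (ENNReal.ofReal_toReal fun htop => ?_).symm
    have := hc t ⟨h, ht⟩
    rw [htop, ENNReal.mul_top (by simpa using h)] at this
    exact ENNReal.ofReal_ne_top this.symm

theorem IsWeighting.continuousOn_renewal (hw : IsWeighting w) (hT : 0 < T) :
    ContinuousOn (renewal w T) (Ioc 0 T) := by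
  obtain ⟨c, hcc, hc⟩ := hw.exists_continuous_ofReal_mul_resolvent hT
  have : ContinuousOn (fun t => max 0 (c t) / t) (Ioc 0 T) :=
    ContinuousOn.div (by fun_prop) (by fun_prop) fun t ht => ht.1.ne'
  refine this.congr fun t ht => ?_
  have h := congrArg ENNReal.toReal (hc t ht)
  rw [ENNReal.toReal_mul, ENNReal.toReal_ofReal ht.1.le, ENNReal.toReal_ofReal'] at h
  rw [eq_div_iff ht.1.ne', max_comm, ← h, renewal, mul_comm]

theorem IsWeighting.intervalIntegrable_exp_mul_renewal (hw : IsWeighting w) (hT : 0 < T)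
    (a b : ℝ) : IntervalIntegrable (fun s => Real.exp s * renewal w T s) volume a b :=
  (hw.integrable_renewal hT).intervalIntegrable.continuousOn_mul (by fun_prop)

theorem IsWeighting.continuous_renewalAverage (hw : IsWeighting w) (hT : 0 < T) :
    Continuous (renewalAverage w T) := by
  have := intervalIntegral.continuous_primitive (hw.intervalIntegrable_exp_mul_renewal hT) 0
  unfold renewalAverage
  fun_prop

theorem IsWeighting.continuousOn_multiplier (hw : IsWeighting w) (hT : 0 < T) :
    ContinuousOn (multiplier w T) (Ioc 0 T) :=
  (hw.continuousOn_renewal hT).sub (hw.continuous_renewalAverage hT).continuousOn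

theorem renewalAverage_nonneg {t : ℝ} (ht : 0 ≤ t) : 0 ≤ renewalAverage w T t := by
  have : 0 ≤ ∫ s in (0 : ℝ)..t, Real.exp s * renewal w T s :=
    intervalIntegral.integral_nonneg ht fun s _ => mul_nonneg (Real.exp_pos s).le (renewal_nonneg s)
  unfold renewalAverage
  positivity

/-- This is the form `y = e + e⋆R` of the average, which makes it accessible to convolution algebra.
-/
theorem IsWeighting.expStep_lconvolution_resolvent (hw : IsWeighting w) (hT : 0 < T) {t : ℝ}
    (ht : t ∈ Icc 0 T) : (expStep ⋆ₗ resolvent (density w T)) t =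
      ENNReal.ofReal (renewalAverage w T t - Real.exp (-t)) := by
  have hi := hw.intervalIntegrable_exp_mul_renewal hT 0 t
  have h1 : renewalAverage w T t - Real.exp (-t) =
      ∫ s in Ioo 0 t, Real.exp (-t) * (Real.exp s * renewal w T s) := by
    rw [integral_const_mul, ← integral_Ioc_eq_integral_Ioo,
      ← intervalIntegral.integral_of_le ht.1, renewalAverage]
    ring
  rw [h1, lconvolution_eq_setLIntegral (fun _ => expStep_of_neg)
    (fun _ h => resolvent_of_nonpos (fun _ => density_of_nonpos) h.le),
    ofReal_integral_eq_lintegral_ofReal]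
  · refine setLIntegral_congr_fun measurableSet_Ioo fun s hs => ?_
    rw [expStep_of_nonneg (by linarith [hs.2]), hw.resolvent_eq_ofReal hT (hs.2.le.trans ht.2),
      ← mul_assoc, ← Real.exp_add, ENNReal.ofReal_mul (Real.exp_pos _).le]
    ring_nf
  · exact (((intervalIntegrable_iff_integrableOn_Ioo_of_le ht.1).1 hi).const_mul _)
  · exact ae_of_all _ fun s => mul_nonneg (Real.exp_pos _).le
      (mul_nonneg (Real.exp_pos _).le (renewal_nonneg _))

theorem exp_neg_le_renewalAverage {t : ℝ} (ht : 0 ≤ t) :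
    Real.exp (-t) ≤ renewalAverage w T t := by
  have : 0 ≤ ∫ s in (0 : ℝ)..t, Real.exp s * renewal w T s :=
    intervalIntegral.integral_nonneg ht fun s _ => mul_nonneg (Real.exp_pos s).le (renewal_nonneg s)
  exact le_mul_of_one_le_right (Real.exp_pos _).le (by linarith)

/-- The renewal equation. -/
theorem IsWeighting.integral_survival_mul_renewal (hw : IsWeighting w) (hT : 0 < T) {t : ℝ}
    (ht : t ∈ Icc 0 T) :
    IntervalIntegrable (fun s => w (Real.exp (-t + s)) * renewal w T s) volume 0 t ∧
      ∫ s in (0 : ℝ)..t, w (Real.exp (-t + s)) * renewal w T s = 1 - w (Real.exp (-t)) := by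
  have hk := hw.measurable_survival (T := T)
  have hR := measurable_resolvent (measurable_density (w := w) (T := T))
  have hle := hw.le_one (exp_neg_mem_Icc ht.1)
  have hnn := hw.nonneg (exp_neg_mem_Icc ht.1)
  refine integral_eq_of_lconvolution_eq hk hR (fun _ => survival_of_neg)
    (fun _ h => resolvent_of_nonpos (fun _ => density_of_nonpos) h.le) ht.1 (by linarith) ?_
    (fun s hs => ?_) (fun s hs => ?_) (fun s hs => hw.resolvent_eq_ofReal hT (hs.2.le.trans ht.2))
    (fun s _ => renewal_nonneg s)
  · have h := congrFun (hw.survival_add_renewal hT) t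
    rw [Pi.add_apply, unitStep_of_nonneg ht.1, survival_of_mem ht] at h
    rw [ENNReal.ofReal_sub _ hnn, ENNReal.ofReal_one, ← h,
      ENNReal.add_sub_cancel_left ENNReal.ofReal_ne_top]
  · rw [survival_of_mem ⟨by linarith [hs.2], by linarith [hs.1, ht.2]⟩]
    congr 3; ring
  · rw [show -t + s = -(t - s) by ring]
    exact hw.nonneg (exp_neg_mem_Icc (by linarith [hs.2]))

theorem lintegral_exp_neg {t : ℝ} (ht : 0 ≤ t) :
    ∫⁻ s in Ioo 0 t, ENNReal.ofReal (Real.exp (-s)) = ENNReal.ofReal (1 - Real.exp (-t)) := by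
  have hi : IntegrableOn (fun s => Real.exp (-s)) (Ioo 0 t) :=
    ((by fun_prop : Continuous fun s => Real.exp (-s)).integrableOn_Icc).mono_set Ioo_subset_Icc_self
  rw [← ofReal_integral_eq_lintegral_ofReal hi (ae_of_all _ fun s => (Real.exp_pos _).le),
    ← integral_Ioc_eq_integral_Ioo, ← intervalIntegral.integral_of_le ht]
  congr 1
  have := intervalIntegral.integral_comp_neg (a := 0) (b := t) (f := Real.exp)
  rw [this]
  simp

/-- In convolution algebra, `k⋆(e + e⋆R) = (k + k⋆R)⋆e = 1⋆e`. -/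
theorem IsWeighting.integral_survival_mul_renewalAverage (hw : IsWeighting w) (hT : 0 < T) {t : ℝ}
    (ht : t ∈ Icc 0 T) :
    IntervalIntegrable (fun s => w (Real.exp (-t + s)) * renewalAverage w T s) volume 0 t ∧
      ∫ s in (0 : ℝ)..t, w (Real.exp (-t + s)) * renewalAverage w T s = 1 - Real.exp (-t) := by
  have hk := hw.measurable_survival (T := T)
  have hR := measurable_resolvent (measurable_density (w := w) (T := T))
  have he := measurable_expStep
  have hle := (exp_neg_mem_Icc ht.1).2
  refine integral_eq_of_lconvolution_eq (g := expStep + expStep ⋆ₗ resolvent (density w T)) hk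
    (he.add (measurable_lconvolution _ he hR)) (fun _ => survival_of_neg)
    (fun s hs => ?_) ht.1 (by linarith) ?_
    (fun s hs => ?_) (fun s hs => ?_) (fun s hs => ?_) (fun s hs => renewalAverage_nonneg hs.1.le)
  · rw [Pi.add_apply, expStep_of_neg hs, lconvolution_of_neg (fun _ => expStep_of_neg)
      (fun _ h => resolvent_of_nonpos (fun _ => density_of_nonpos) h.le) hs, add_zero]
  · rw [lconvolution_add_right hk he, lconvolution_comm (f := expStep),
      lconvolution_assoc hk hR he,
      ← lconvolution_add_left hk he, hw.survival_add_renewal hT,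
      unitStep_lconvolution fun _ => expStep_of_neg, ← lintegral_exp_neg ht.1]
    exact setLIntegral_congr_fun measurableSet_Ioo fun s hs => expStep_of_nonneg hs.1.le
  · rw [survival_of_mem ⟨by linarith [hs.2], by linarith [hs.1, ht.2]⟩]
    congr 3; ring
  · rw [show -t + s = -(t - s) by ring]
    exact hw.nonneg (exp_neg_mem_Icc (by linarith [hs.2]))
  · rw [Pi.add_apply, expStep_of_nonneg hs.1.le,
      hw.expStep_lconvolution_resolvent hT ⟨hs.1.le, hs.2.le.trans ht.2⟩,
      ← ENNReal.ofReal_add (Real.exp_pos _).le]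
    · congr 1; ring
    · linarith [exp_neg_le_renewalAverage (w := w) (T := T) hs.1.le]

/-- Subtract `k⋆y = 1 - e` from `k⋆R = 1 - k`. -/
theorem IsWeighting.isMultiplier_multiplier (hw : IsWeighting w) (hT : 0 < T) :
    IsMultiplier w T (multiplier w T) := by
  refine ⟨(hw.integrable_renewal hT).integrableOn.sub
    (hw.continuous_renewalAverage hT).integrableOn_Icc, fun t ht => ?_⟩
  obtain ⟨i1, h1⟩ := hw.integral_survival_mul_renewal hT ht
  obtain ⟨i2, h2⟩ := hw.integral_survival_mul_renewalAverage hT ht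
  simp only [multiplier, mul_sub]
  rw [intervalIntegral.integral_sub i1 i2, h1, h2]
  ring

/-- The derivative of the equation that defines the multiplier. -/
theorem IsWeighting.integral_deriv_mul_multiplier (hw : IsWeighting w) (hT : 0 < T) {t : ℝ}
    (ht : t ∈ Ioc 0 T) :
    IntervalIntegrable (fun s => Real.exp (-t + s) * deriv w (Real.exp (-t + s)) *
      multiplier w T s) volume 0 t ∧
    Real.exp (-t) * deriv w (Real.exp (-t)) +
      ∫ s in (0 : ℝ)..t, Real.exp (-t + s) * deriv w (Real.exp (-t + s)) * multiplier w T s =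
        multiplier w T t + Real.exp (-t) := by
  have hm := measurable_density (w := w) (T := T)
  have hm0 : ∀ s ≤ 0, density w T s = 0 := fun _ => density_of_nonpos
  have hR := measurable_resolvent hm
  have he := measurable_expStep
  have hd := hw.density_nonneg ht.1
  have heq := congrFun (resolvent_eq hm) t
  rw [Pi.add_apply, density_of_mem ht, hw.resolvent_eq_ofReal hT ht.2] at heq
  have hle : Real.exp (-t) * deriv w (Real.exp (-t)) ≤ renewal w T t := by
    rw [← ENNReal.ofReal_le_ofReal_iff (renewal_nonneg t), heq]
    exact le_self_add
  have ha : ∀ s ∈ Ioo 0 t, density w T (t - s) =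
      ENNReal.ofReal (Real.exp (-t + s) * deriv w (Real.exp (-t + s))) := fun s hs => by
    rw [density_of_mem ⟨by linarith [hs.2], by linarith [hs.1, ht.2]⟩, neg_sub, sub_eq_neg_add]
  have ha0 : ∀ s ∈ Ioo 0 t, 0 ≤ Real.exp (-t + s) * deriv w (Real.exp (-t + s)) := fun s hs => by
    rw [show -t + s = -(t - s) by ring]
    exact hw.density_nonneg (by linarith [hs.2])
  -- Nothing is differentiated. The resolvent equation gives `m⋆R = R - m` and `m⋆(e + e⋆R) = (m +
  -- m⋆R)⋆e = R⋆e = y - e`; the claim is the difference of the two.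
  obtain ⟨i1, h1⟩ := integral_eq_of_lconvolution_eq hm hR (fun s hs => hm0 s hs.le)
    (fun _ h => resolvent_of_nonpos hm0 h.le) ht.1.le (sub_nonneg.2 hle)
    (by rw [ENNReal.ofReal_sub _ hd, heq, ENNReal.add_sub_cancel_left ENNReal.ofReal_ne_top])
    ha ha0 (fun s hs => hw.resolvent_eq_ofReal hT (hs.2.le.trans ht.2)) (fun s _ => renewal_nonneg s)
  obtain ⟨i2, h2⟩ := integral_eq_of_lconvolution_eq
    (g := expStep + expStep ⋆ₗ resolvent (density w T)) hm
    (he.add (measurable_lconvolution _ he hR)) (fun s hs => hm0 s hs.le)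
    (fun s hs => by
      rw [Pi.add_apply, expStep_of_neg hs, lconvolution_of_neg (fun _ => expStep_of_neg)
        (fun _ h => resolvent_of_nonpos hm0 h.le) hs, add_zero]) ht.1.le
    (sub_nonneg.2 (exp_neg_le_renewalAverage ht.1.le))
    (by
      rw [lconvolution_add_right hm he, lconvolution_comm (f := expStep) (g := resolvent _),
        lconvolution_assoc hm hR he,
        ← lconvolution_add_left hm he, ← resolvent_eq hm,
        lconvolution_comm, hw.expStep_lconvolution_resolvent hT (Ioc_subset_Icc_self ht)])
    ha ha0
    (fun s hs => by
      rw [Pi.add_apply, expStep_of_nonneg hs.1.le,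
        hw.expStep_lconvolution_resolvent hT ⟨hs.1.le, hs.2.le.trans ht.2⟩,
        ← ENNReal.ofReal_add (Real.exp_pos _).le
          (sub_nonneg.2 (exp_neg_le_renewalAverage hs.1.le)), add_sub_cancel])
    (fun s hs => renewalAverage_nonneg hs.1.le)
  simp only [multiplier, mul_sub]
  refine ⟨i1.sub i2, ?_⟩
  rw [intervalIntegral.integral_sub i1 i2, h1, h2]
  ring

/-- Near `0` one has `R ≥ m ≥ e^{-t} w'(q)` for a fixed `q` with `w'(q) > 1`, while `y = e^{-t}(1 +
o(1))`. No finite limit of the multiplier at `0` is needed. -/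
theorem IsWeighting.eventually_multiplier_pos (hw : IsWeighting w) (hT : 0 < T) :
    ∀ᶠ t in 𝓝[>] (0 : ℝ), 0 < multiplier w T t := by
  obtain ⟨q, hq, hq1, hmono⟩ := hw.exists_monotoneOn_deriv
  have hcont := intervalIntegral.continuous_primitive
    (hw.intervalIntegrable_exp_mul_renewal hT) 0
  have hlim : Tendsto (fun t => ∫ s in (0 : ℝ)..t, Real.exp s * renewal w T s) (𝓝[>] 0) (𝓝 0) := by
    simpa using (hcont.tendsto 0).mono_left nhdsWithin_le_nhds
  have hexp : Tendsto (fun u : ℝ => Real.exp (-u)) (𝓝[>] 0) (𝓝 1) := by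
    have : Continuous fun u : ℝ => Real.exp (-u) := by fun_prop
    simpa using (this.tendsto 0).mono_left nhdsWithin_le_nhds
  filter_upwards [hlim.eventually_lt_const (show (0 : ℝ) < deriv w q - 1 by linarith),
    hexp.eventually_const_lt hq.2, Ioc_mem_nhdsGT hT] with t h1 h2 ht
  have hmem := exp_neg_mem_Ioo ht.1
  have h3 : deriv w q ≤ deriv w (Real.exp (-t)) := hmono ⟨le_rfl, hq.2⟩ ⟨h2.le, hmem.2⟩ h2.le
  have heq := congrFun (resolvent_eq (measurable_density (w := w) (T := T))) t
  rw [Pi.add_apply, density_of_mem ht, hw.resolvent_eq_ofReal hT ht.2] at heq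
  have hle : Real.exp (-t) * deriv w (Real.exp (-t)) ≤ renewal w T t := by
    rw [← ENNReal.ofReal_le_ofReal_iff (renewal_nonneg t), heq]
    exact le_self_add
  have h4 : renewalAverage w T t < Real.exp (-t) * deriv w q :=
    mul_lt_mul_of_pos_left (by linarith) hmem.1
  have h5 := mul_le_mul_of_nonneg_left h3 hmem.1.le
  rw [multiplier]
  linarith

end

/-! ### Loads of payment measures, Volterra uniqueness, and the cutoff time. -/

section

variable {w : ℝ → ℝ} {T : ℝ}

/-- The function `u ↦ w (exp (-u))` on the half-line. -/
def tail (w : ℝ → ℝ) : ℝ → ℝ≥0∞ := indicator (Ici 0) fun u => ENNReal.ofReal (w (Real.exp (-u)))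

/-- The distorted expectation at time `t` of the payments that are made from time `t` on according
to the payment measure `μ` until an exponential time. -/
def load (w : ℝ → ℝ) (μ : Measure ℝ) (t : ℝ) : ℝ≥0∞ := ∫⁻ s, tail w (s - t) ∂μ

theorem tail_of_neg {u : ℝ} (hu : u < 0) : tail w u = 0 := indicator_of_notMem (not_le.2 hu) _

theorem tail_of_nonneg {u : ℝ} (hu : 0 ≤ u) : tail w u = ENNReal.ofReal (w (Real.exp (-u))) :=
  indicator_of_mem (mem_Ici.2 hu) _

theorem survival_eq_tail {u : ℝ} (hu : u ≤ T) : survival w T u = tail w u := by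
  rcases lt_or_ge u 0 with h | h
  · rw [survival_of_neg h, tail_of_neg h]
  · rw [survival_of_mem ⟨h, hu⟩, tail_of_nonneg h]

theorem IsWeighting.measurable_tail (hw : IsWeighting w) : Measurable (tail w) := by
  have h : Continuous fun u => w (Real.exp (-(max 0 u))) :=
    hw.continuousOn.comp_continuous (by fun_prop) fun _ => exp_neg_mem_Icc (le_max_left _ _)
  have : tail w = indicator (Ici 0) fun u => ENNReal.ofReal (w (Real.exp (-(max 0 u)))) :=
    indicator_congr fun u hu => by rw [max_eq_right hu]
  rw [this]
  exact (ENNReal.measurable_ofReal.comp h.measurable).indicator measurableSet_Ici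

section Uniqueness

/-- A payment measure is recovered from its load by means of the renewal density. -/
theorem IsWeighting.measure_Ici_eq (hw : IsWeighting w) (hT : 0 < T) (μ : Measure ℝ) [SFinite μ]
    (t : ℝ) : ∫⁻ s, survival w T (s - t) ∂μ +
      ∫⁻ v, resolvent (density w T) (v - t) * ∫⁻ s, survival w T (s - v) ∂μ = μ (Ici t) := by
  have hk := hw.measurable_survival (T := T)
  have hR := measurable_resolvent (measurable_density (w := w) (T := T))
  have h1 : ∀ v, resolvent (density w T) (v - t) * ∫⁻ s, survival w T (s - v) ∂μ =
      ∫⁻ s, resolvent (density w T) (v - t) * survival w T (s - v) ∂μ :=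
    fun v => (lintegral_const_mul _ (by fun_prop)).symm
  simp only [h1]
  rw [lintegral_lintegral_swap (by fun_prop), ← lintegral_add_left (by fun_prop)]
  -- After Tonelli, the kernel in `s` is `k + k⋆R` evaluated at `s - t`, which is the unit step.
  have h2 : ∀ s, survival w T (s - t) +
      ∫⁻ v, resolvent (density w T) (v - t) * survival w T (s - v) = (Ici t).indicator 1 s := by
    intro s
    have h3 : ∫⁻ v, resolvent (density w T) (v - t) * survival w T (s - v) =
        (survival w T ⋆ₗ resolvent (density w T)) (s - t) := by
      rw [lconvolution_comm, lconvolution_def, ← lintegral_add_right_eq_self _ t]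
      refine lintegral_congr fun y => ?_
      congr 2 <;> ring
    have h4 := congrFun (hw.survival_add_renewal hT) (s - t)
    rw [h3, ← Pi.add_apply, h4]
    by_cases hs : t ≤ s
    · rw [unitStep_of_nonneg (by linarith), indicator_of_mem (mem_Ici.2 hs)]; rfl
    · rw [unitStep_of_neg (by linarith), indicator_of_notMem (by simpa using hs)]
  simp only [h2]
  rw [lintegral_indicator_one measurableSet_Ici]

/-- Payments that end by `S ≤ T` do not see the truncation of the kernel. -/
theorem load_eq_survival {μ : Measure ℝ} {S : ℝ} (hS : S ≤ T) (hμ : μ (Ioi S) = 0) {t : ℝ}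
    (ht : 0 ≤ t) : ∫⁻ s, survival w T (s - t) ∂μ = load w μ t := by
  refine lintegral_congr_ae ?_
  have : ∀ᵐ s ∂μ, s ∉ Ioi S := measure_eq_zero_iff_ae_notMem.1 hμ
  filter_upwards [this] with s hs
  rw [survival_eq_tail]
  rw [mem_Ioi, not_lt] at hs
  linarith

theorem load_eq_zero {μ : Measure ℝ} {S : ℝ} (hμ : μ (Ioi S) = 0) {t : ℝ} (ht : S < t) :
    load w μ t = 0 := by
  rw [load, ← lintegral_zero (μ := μ)]
  refine lintegral_congr_ae ?_
  have : ∀ᵐ s ∂μ, s ∉ Ioi S := measure_eq_zero_iff_ae_notMem.1 hμ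
  filter_upwards [this] with s hs
  rw [mem_Ioi, not_lt] at hs
  exact tail_of_neg (by linarith)

/-- The inversion formula uses the load at `t` itself, but later loads only under an integral.
Almost everywhere equality suffices there, and complementary slackness gives no more. -/
theorem IsWeighting.measure_Ici_congr (hw : IsWeighting w) (hT : 0 < T) {μ μ' : Measure ℝ}
    [SFinite μ] [SFinite μ'] {S : ℝ} (hS : S ≤ T) (hμ : μ (Ioi S) = 0) (hμ' : μ' (Ioi S) = 0)
    {t : ℝ} (ht : 0 ≤ t) (h : load w μ t = load w μ' t)
    (hae : ∀ᵐ v ∂volume.restrict (Ioo t S), load w μ v = load w μ' v) :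
    μ (Ici t) = μ' (Ici t) := by
  rw [← hw.measure_Ici_eq hT μ t, ← hw.measure_Ici_eq hT μ' t, load_eq_survival hS hμ ht,
    load_eq_survival hS hμ' ht, h]
  congr 1
  refine lintegral_congr_ae ?_
  rw [ae_restrict_iff' measurableSet_Ioo] at hae
  filter_upwards [hae, compl_mem_ae_iff.2 (measure_singleton S)] with v hv hvS
  rcases le_or_gt v t with h1 | h1
  · rw [resolvent_of_nonpos (fun _ => density_of_nonpos) (by linarith), zero_mul, zero_mul]
  · rw [load_eq_survival hS hμ (by linarith), load_eq_survival hS hμ' (by linarith)]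
    rcases lt_or_ge v S with h2 | h2
    · rw [hv ⟨h1, h2⟩]
    · have h3 : S < v := lt_of_le_of_ne h2 (Ne.symm hvS)
      rw [load_eq_zero hμ h3, load_eq_zero hμ' h3]

theorem IsWeighting.intervalIntegrable_mul (hw : IsWeighting w) {S t : ℝ} (ht : t ∈ Icc 0 S)
    {f : ℝ → ℝ} (hf : IntegrableOn f (Icc 0 S)) :
    IntervalIntegrable (fun s => w (Real.exp (-s + t)) * f s) volume t S := by
  have h1 : IntervalIntegrable f volume t S := by
    rw [intervalIntegrable_iff_integrableOn_Icc_of_le ht.2]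
    exact hf.mono_set (Icc_subset_Icc_left ht.1)
  refine h1.continuousOn_mul ?_
  rw [uIcc_of_le ht.2]
  refine hw.continuousOn.comp (by fun_prop) fun s hs => ?_
  rw [show -s + t = -(s - t) by ring]
  exact exp_neg_mem_Icc (by linarith [hs.1])

theorem IsWeighting.load_withDensity (hw : IsWeighting w) {S t : ℝ} (ht : t ∈ Icc 0 S)
    {f : ℝ → ℝ} (hf : IntegrableOn f (Icc 0 S)) :
    load w ((volume.restrict (Icc 0 S)).withDensity fun s => ENNReal.ofReal (f s)) t =
      ∫⁻ s in Ioc t S, ENNReal.ofReal (w (Real.exp (-s + t)) * f s) := by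
  have hm := hw.measurable_tail
  rw [load, lintegral_withDensity_eq_lintegral_mul₀ hf.aemeasurable.ennreal_ofReal
    (by fun_prop), setLIntegral_congr Ioc_ae_eq_Icc, ← lintegral_indicator measurableSet_Icc,
    ← lintegral_indicator measurableSet_Icc]
  refine lintegral_congr fun s => ?_
  by_cases hs : s ∈ Icc t S
  · have h1 : 0 ≤ s - t := by linarith [hs.1]
    rw [indicator_of_mem hs, indicator_of_mem (show s ∈ Icc 0 S from ⟨ht.1.trans hs.1, hs.2⟩), Pi.mul_apply,
      tail_of_nonneg h1, show -s + t = -(s - t) by ring,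
      ENNReal.ofReal_mul (hw.nonneg (exp_neg_mem_Icc h1)), mul_comm]
  · rw [indicator_of_notMem hs]
    by_cases hs' : s ∈ Icc 0 S
    · have : s < t := by
        by_contra! h
        exact hs ⟨h, hs'.2⟩
      rw [indicator_of_mem hs', Pi.mul_apply, tail_of_neg (by linarith), mul_zero]
    · rw [indicator_of_notMem hs']

theorem withDensity_restrict_Icc_Ioi (S : ℝ) (f : ℝ → ℝ≥0∞) :
    ((volume.restrict (Icc 0 S)).withDensity f) (Ioi S) = 0 := by
  rw [withDensity_apply _ measurableSet_Ioi, Measure.restrict_restrict measurableSet_Ioi]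
  have : Ioi S ∩ Icc 0 S = ∅ := by
    ext s; simp only [mem_inter_iff, mem_Ioi, mem_Icc, mem_empty_iff_false, iff_false]; intro h
    linarith [h.1, h.2.2]
  simp [this]

/-- Uniqueness for Volterra equations of the first kind with kernel `w (exp (-(s - t)))`. -/
theorem IsWeighting.ae_eq_of_integral_eq (hw : IsWeighting w) {S : ℝ} (hS : 0 < S)
    {f f' : ℝ → ℝ} (hf : IntegrableOn f (Icc 0 S)) (hf' : IntegrableOn f' (Icc 0 S))
    (h : ∀ t ∈ Icc 0 S, ∫ s in t..S, w (Real.exp (-s + t)) * f s =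
      ∫ s in t..S, w (Real.exp (-s + t)) * f' s) :
    f =ᵐ[volume.restrict (Icc 0 S)] f' := by
  -- The inversion formula concerns positive measures, so it is applied to the positive and negative
  -- parts of the difference, which have equal loads.
  set d : ℝ → ℝ := fun s => f s - f' s with hd
  have hdi : IntegrableOn d (Icc 0 S) := hf.sub hf'
  set μ := (volume.restrict (Icc 0 S)).withDensity fun s => ENNReal.ofReal (d s)
  set μ' := (volume.restrict (Icc 0 S)).withDensity fun s => ENNReal.ofReal (-d s)
  have hload : ∀ t ∈ Icc 0 S, load w μ t = load w μ' t := by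
    intro t ht
    have hi := hw.intervalIntegrable_mul ht hdi
    have h0 : ∫ s in t..S, w (Real.exp (-s + t)) * d s = 0 := by
      simp only [hd, mul_sub]
      rw [intervalIntegral.integral_sub (hw.intervalIntegrable_mul ht hf)
        (hw.intervalIntegrable_mul ht hf'), h t ht, sub_self]
    rw [intervalIntegrable_iff_integrableOn_Ioc_of_le ht.2] at hi
    rw [intervalIntegral.integral_of_le ht.2,
      integral_eq_lintegral_pos_part_sub_lintegral_neg_part hi, sub_eq_zero,
      ENNReal.toReal_eq_toReal_iff'] at h0
    · have hneg : IntegrableOn (fun s => -d s) (Icc 0 S) := hdi.neg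
      rw [hw.load_withDensity ht hdi, hw.load_withDensity ht hneg, h0]
      simp only [mul_neg]
    · exact hi.lintegral_lt_top.ne
    · exact hi.neg.lintegral_lt_top.ne
  have : IsFiniteMeasure μ := isFiniteMeasure_withDensity_ofReal hdi.2
  have : IsFiniteMeasure μ' := isFiniteMeasure_withDensity_ofReal hdi.neg.2
  have hμ : μ (Ioi S) = 0 := withDensity_restrict_Icc_Ioi S _
  have hμ' : μ' (Ioi S) = 0 := withDensity_restrict_Icc_Ioi S _
  have key : ∀ t ∈ Icc 0 S, μ (Ici t) = μ' (Ici t) := fun t ht =>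
    hw.measure_Ici_congr hS le_rfl hμ hμ' ht.1 (hload t ht) (by
      filter_upwards [ae_restrict_mem measurableSet_Ioo] with v hv
      exact hload v ⟨ht.1.trans hv.1.le, hv.2.le⟩)
  have hIci : ∀ t < 0, ∀ φ : ℝ → ℝ≥0∞, ((volume.restrict (Icc 0 S)).withDensity φ) (Ici t) =
      ((volume.restrict (Icc 0 S)).withDensity φ) (Ici 0) := fun t ht φ => by
    rw [withDensity_apply _ measurableSet_Ici, withDensity_apply _ measurableSet_Ici,
      Measure.restrict_restrict measurableSet_Ici, Measure.restrict_restrict measurableSet_Ici]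
    congr 2
    ext s
    simp only [mem_inter_iff, mem_Ici, mem_Icc]
    constructor <;> rintro ⟨h1, h2, h3⟩ <;> exact ⟨by linarith, h2, h3⟩
  have heq : μ = μ' := by
    refine Measure.ext_of_Ici _ _ fun t => ?_
    rcases lt_or_ge t 0 with h1 | h1
    · rw [hIci t h1, hIci t h1]
      exact key 0 ⟨le_rfl, hS.le⟩
    rcases le_or_gt t S with h2 | h2
    · exact key t ⟨h1, h2⟩
    · rw [measure_mono_null (Ici_subset_Ioi.2 h2) hμ, measure_mono_null (Ici_subset_Ioi.2 h2) hμ']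
  have hae := (withDensity_eq_iff hdi.aemeasurable.ennreal_ofReal
    hdi.neg.aemeasurable.ennreal_ofReal hdi.lintegral_lt_top.ne).1 heq
  filter_upwards [hae] with s hs
  have hs : ENNReal.ofReal (d s) = ENNReal.ofReal (-d s) := hs
  have : d s = 0 := by
    rcases lt_trichotomy (d s) 0 with h1 | h1 | h1
    · rw [ENNReal.ofReal_of_nonpos h1.le, eq_comm, ENNReal.ofReal_eq_zero] at hs; linarith
    · exact h1
    · rw [ENNReal.ofReal_of_nonpos (p := -d s) (by linarith), ENNReal.ofReal_eq_zero] at hs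
      linarith
  simp only [hd] at this
  linarith

theorem IsWeighting.isBindingFlow_unique (hw : IsWeighting w) {S : ℝ} (hS : 0 < S) {f f' : ℝ → ℝ}
    (hf : IsBindingFlow w S f) (hf' : IsBindingFlow w S f') :
    f =ᵐ[volume.restrict (Icc 0 S)] f' :=
  hw.ae_eq_of_integral_eq hS hf.1 hf'.1 fun t ht => by linarith [hf.2 t ht, hf'.2 t ht]

theorem measurePreserving_sub_left_restrict_Icc (S : ℝ) :
    MeasurePreserving (fun s : ℝ => S - s) (volume.restrict (Icc 0 S))
      (volume.restrict (Icc 0 S)) := by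
  have h := (Measure.measurePreserving_sub_left volume S).restrict_preimage
    (measurableSet_Icc (a := (0 : ℝ)) (b := S))
  have h2 : (fun s : ℝ => S - s) ⁻¹' Icc 0 S = Icc 0 S := by simp
  rwa [h2] at h

/-- The reflection `s ↦ S - s` turns this equation into the Volterra equation for flows. -/
theorem IsWeighting.isMultiplier_unique (hw : IsWeighting w) {S : ℝ} (hS : 0 < S) {g g' : ℝ → ℝ}
    (hg : IsMultiplier w S g) (hg' : IsMultiplier w S g') :
    g =ᵐ[volume.restrict (Icc 0 S)] g' := by
  have hmp := measurePreserving_sub_left_restrict_Icc S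
  have hrefl : ∀ φ : ℝ → ℝ, ∀ t, ∫ s in t..S, w (Real.exp (-s + t)) * φ (S - s) =
      ∫ s in (0 : ℝ)..(S - t), w (Real.exp (-(S - t) + s)) * φ s := by
    intro φ t
    have := intervalIntegral.integral_comp_sub_left (a := t) (b := S)
      (fun u => w (Real.exp (-(S - t) + u)) * φ u) S
    rw [sub_self] at this
    rw [← this]
    congr 1
    ext s
    congr 3
    ring
  have h := hw.ae_eq_of_integral_eq hS (f := fun s => g (S - s)) (f' := fun s => g' (S - s))
    (hmp.integrable_comp_of_integrable hg.1) (hmp.integrable_comp_of_integrable hg'.1)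
    fun t ht => by
      have ht' : S - t ∈ Icc 0 S := ⟨by linarith [ht.2], by linarith [ht.1]⟩
      rw [hrefl, hrefl]
      linarith [hg.2 _ ht', hg'.2 _ ht']
  filter_upwards [hmp.quasiMeasurePreserving.ae h] with s hs
  simpa using hs

end Uniqueness

/-- The renewal density run backwards makes the constraints bind. -/
theorem IsWeighting.isBindingFlow_renewal (hw : IsWeighting w) (hT : 0 < T) {S : ℝ} (hS : S ≤ T) :
    IsBindingFlow w S fun s => renewal w T (S - s) := by
  refine ⟨(measurePreserving_sub_left_restrict_Icc S).integrable_comp_of_integrable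
    (hw.integrable_renewal hT).integrableOn, fun t ht => ?_⟩
  have h := (hw.integral_survival_mul_renewal hT (t := S - t)
    ⟨by linarith [ht.2], by linarith [ht.1]⟩).2
  have hrefl := intervalIntegral.integral_comp_sub_left (a := t) (b := S)
      (fun u => w (Real.exp (-(S - t) + u)) * renewal w T u) S
  rw [sub_self, h] at hrefl
  have heq : ∫ s in t..S, w (Real.exp (-s + t)) * renewal w T (S - s) =
      1 - w (Real.exp (-(S - t))) := by
    rw [← hrefl]
    congr 1
    ext s
    congr 3
    ring
  rw [heq, show -S + t = -(S - t) by ring]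
  ring

/-- If the multiplier were positive on all of `(0, T]`, the integral in its equation at `T` would be
positive, yet it vanishes because `e^{-T}` is a fixed point. Positivity near `0` keeps the set away
from `0`, so it is compact. -/
theorem IsWeighting.exists_isLeast (hw : IsWeighting w) (hT : 0 < T)
    (hfix : w (Real.exp (-T)) = Real.exp (-T)) :
    ∃ t₀, IsLeast {t | t ∈ Ioc 0 T ∧ multiplier w T t ≤ 0} t₀ := by
  have hne : ∃ t ∈ Ioc 0 T, multiplier w T t ≤ 0 := by
    by_contra! hpos
    have h := (hw.isMultiplier_multiplier hT).2 T ⟨hT.le, le_rfl⟩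
    have hi := (hw.integral_survival_mul_renewal hT (t := T) ⟨hT.le, le_rfl⟩).1.sub
      (hw.integral_survival_mul_renewalAverage hT (t := T) ⟨hT.le, le_rfl⟩).1
    simp only [← mul_sub] at hi
    have hint := intervalIntegral.intervalIntegral_pos_of_pos_on
      (f := fun s => w (Real.exp (-T + s)) * multiplier w T s) hi
      (fun s hs => mul_pos (by
        rw [show -T + s = -(T - s) by ring]
        exact hw.pos (exp_neg_mem_Ioc (by linarith [hs.2]))) (hpos s ⟨hs.1, hs.2.le⟩)) hT
    rw [hfix] at h
    linarith
  obtain ⟨δ, hδ, hpos⟩ := (mem_nhdsGT_iff_exists_Ioo_subset).1 (hw.eventually_multiplier_pos hT)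
  have hδ : 0 < δ := hδ
  have heq : {t | t ∈ Ioc 0 T ∧ multiplier w T t ≤ 0} =
      Icc δ T ∩ multiplier w T ⁻¹' Iic 0 := by
    ext t
    simp only [mem_ofPred_eq, mem_inter_iff, mem_preimage, mem_Iic, mem_Icc, mem_Ioc]
    refine ⟨fun ⟨⟨h1, h2⟩, h3⟩ => ⟨⟨?_, h2⟩, h3⟩, fun ⟨⟨h1, h2⟩, h3⟩ => ⟨⟨hδ.trans_le h1, h2⟩, h3⟩⟩
    by_contra! h
    exact absurd (hpos ⟨h1, h⟩) (not_lt.2 h3)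
  rw [heq]
  refine IsCompact.exists_isLeast ?_ ?_
  · exact isCompact_Icc.of_isClosed_subset
      (((hw.continuousOn_multiplier hT).mono fun t ht =>
        ⟨hδ.trans_le ht.1, ht.2⟩).preimage_isClosed_of_isClosed isClosed_Icc isClosed_Iic)
      inter_subset_left
  · rw [← heq]
    exact hne

end

/-! ### Linear programming duality. -/

section

variable {w : ℝ → ℝ} {T t₀ : ℝ}

/-- The total shadow cost of a unit payment at time `s`. -/
def shadowCost (w : ℝ → ℝ) (T t₀ s : ℝ) : ℝ≥0∞ :=
  tail w s + ∫⁻ t in Ioo 0 t₀, ENNReal.ofReal (multiplier w T t) * tail w (s - t)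

/-- The total mass of the multipliers. -/
def shadowMass (w : ℝ → ℝ) (T t₀ : ℝ) : ℝ≥0∞ :=
  1 + ∫⁻ t in Ioo 0 t₀, ENNReal.ofReal (multiplier w T t)

/-- The time from which on the multiplier is cut off. -/
abbrev IsCutoff (w : ℝ → ℝ) (T t₀ : ℝ) : Prop :=
  IsLeast {t | t ∈ Ioc 0 T ∧ multiplier w T t ≤ 0} t₀

theorem IsCutoff.pos (h : IsCutoff w T t₀) : 0 < t₀ := h.1.1.1

theorem IsCutoff.le (h : IsCutoff w T t₀) : t₀ ≤ T := h.1.1.2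

theorem IsCutoff.multiplier_pos (h : IsCutoff w T t₀) {t : ℝ} (ht : t ∈ Ioo 0 t₀) :
    0 < multiplier w T t := by
  by_contra! hle
  exact absurd (h.2 ⟨⟨ht.1, ht.2.le.trans h.le⟩, hle⟩) (not_le.2 ht.2)

theorem IsWeighting.measurable_multiplier (hw : IsWeighting w) (hT : 0 < T) :
    Measurable (multiplier w T) :=
  measurable_renewal.sub (hw.continuous_renewalAverage hT).measurable

theorem IsWeighting.measurable_shadowCost (hw : IsWeighting w) (hT : 0 < T) :
    Measurable (shadowCost w T t₀) := by
  have h1 := hw.measurable_tail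
  have h2 := hw.measurable_multiplier hT
  unfold shadowCost
  refine h1.add (Measurable.lintegral_prod_right' (f := fun p : ℝ × ℝ =>
    ENNReal.ofReal (multiplier w T p.2) * tail w (p.1 - p.2)) ?_)
  fun_prop

theorem IsWeighting.shadowMass_ne_top (hw : IsWeighting w) (hT : 0 < T) (h : IsCutoff w T t₀) :
    shadowMass w T t₀ ≠ ∞ := by
  refine ENNReal.add_ne_top.2 ⟨ENNReal.one_ne_top, ?_⟩
  exact ((hw.isMultiplier_multiplier hT).1.mono_set
    (Ioo_subset_Icc_self.trans (Icc_subset_Icc_right h.le))).lintegral_lt_top.ne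

theorem IsWeighting.multiplier_mul_tail (hw : IsWeighting w) {s t : ℝ} (hts : t ≤ s) :
    ENNReal.ofReal (multiplier w T t) * tail w (s - t) =
      ENNReal.ofReal (w (Real.exp (-s + t)) * multiplier w T t) := by
  have h1 : 0 ≤ s - t := sub_nonneg.2 hts
  rw [tail_of_nonneg h1, show -s + t = -(s - t) by ring,
    ENNReal.ofReal_mul (hw.nonneg (exp_neg_mem_Icc h1)), mul_comm]

theorem IsWeighting.intervalIntegrable_mul_multiplier (hw : IsWeighting w) (hT : 0 < T)
    {u s : ℝ} (hu : u ∈ Icc 0 T) (hus : u ≤ s) :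
    IntervalIntegrable (fun t => w (Real.exp (-s + t)) * multiplier w T t) volume 0 u := by
  have h1 : IntervalIntegrable (multiplier w T) volume 0 u := by
    rw [intervalIntegrable_iff_integrableOn_Icc_of_le hu.1]
    exact (hw.isMultiplier_multiplier hT).1.mono_set (Icc_subset_Icc_right hu.2)
  refine h1.continuousOn_mul ?_
  rw [uIcc_of_le hu.1]
  refine hw.continuousOn.comp (by fun_prop) fun t ht => ?_
  rw [show -s + t = -(s - t) by ring]
  exact exp_neg_mem_Icc (by linarith [ht.2])

/-- The shadow cost as an interval integral. -/
theorem IsWeighting.shadowCost_eq (hw : IsWeighting w) (hT : 0 < T) (h : IsCutoff w T t₀)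
    {s : ℝ} (hs : 0 ≤ s) : shadowCost w T t₀ s = ENNReal.ofReal (w (Real.exp (-s)) +
      ∫ t in (0 : ℝ)..min s t₀, w (Real.exp (-s + t)) * multiplier w T t) := by
  have hu : min s t₀ ∈ Icc 0 T := ⟨le_min hs h.pos.le, (min_le_right _ _).trans h.le⟩
  have hi := hw.intervalIntegrable_mul_multiplier hT hu (min_le_left s t₀)
  have hnn : ∀ t ∈ Ioo 0 (min s t₀), 0 ≤ w (Real.exp (-s + t)) * multiplier w T t := by
    intro t ht
    rw [show -s + t = -(s - t) by ring]
    exact mul_nonneg (hw.nonneg (exp_neg_mem_Icc (by linarith [ht.2, min_le_left s t₀])))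
      (h.multiplier_pos ⟨ht.1, ht.2.trans_le (min_le_right _ _)⟩).le
  have hae : ∀ᵐ t ∂volume.restrict (Ioo 0 (min s t₀)),
      0 ≤ w (Real.exp (-s + t)) * multiplier w T t := by
    filter_upwards [ae_restrict_mem measurableSet_Ioo] with t ht using hnn t ht
  rw [intervalIntegral.integral_of_le hu.1, integral_Ioc_eq_integral_Ioo,
    ENNReal.ofReal_add (hw.nonneg (exp_neg_mem_Icc hs)) (integral_nonneg_of_ae hae),
    ofReal_integral_eq_lintegral_ofReal
      ((intervalIntegrable_iff_integrableOn_Ioo_of_le hu.1).1 hi) hae, shadowCost,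
    tail_of_nonneg hs, ← lintegral_indicator measurableSet_Ioo,
    ← lintegral_indicator measurableSet_Ioo]
  congr 1
  refine lintegral_congr_ae ?_
  filter_upwards [compl_mem_ae_iff.2 (measure_singleton s)] with t hts
  by_cases ht : t ∈ Ioo 0 (min s t₀)
  · have h1 : t < s := ht.2.trans_le (min_le_left _ _)
    have h2 : t ∈ Ioo 0 t₀ := ⟨ht.1, ht.2.trans_le (min_le_right _ _)⟩
    rw [indicator_of_mem ht, indicator_of_mem h2, hw.multiplier_mul_tail h1.le]
  · rw [indicator_of_notMem ht]
    by_cases h2 : t ∈ Ioo 0 t₀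
    · have h3 : s < t := by
        refine lt_of_le_of_ne ?_ (Ne.symm hts)
        by_contra! h3
        exact ht ⟨h2.1, lt_min h3 h2.2⟩
      rw [indicator_of_mem h2, tail_of_neg (by linarith), mul_zero]
    · rw [indicator_of_notMem h2]

theorem IsWeighting.shadowCost_of_le (hw : IsWeighting w) (hT : 0 < T) (h : IsCutoff w T t₀)
    {s : ℝ} (hs : s ∈ Icc 0 t₀) : shadowCost w T t₀ s = ENNReal.ofReal (Real.exp (-s)) := by
  rw [hw.shadowCost_eq hT h hs.1, min_eq_left hs.2]
  have := (hw.isMultiplier_multiplier hT).2 s ⟨hs.1, hs.2.trans h.le⟩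
  congr 1
  linarith

/-- Put `x = e^{-(s - t₀)}` and `q = e^{-t₀ + t}`, so that `e^{-s + t} = x q`. Bound `w (x q)` below
by the Hermite interpolant at `0, q, q` and integrate against the atom at `0` plus the multiplier.
The multiplier equation and its derivative at `t₀` evaluate the result as `e^{-s} + (x² - x) g(t₀)`,
where `x² - x < 0` and `g(t₀) ≤ 0`. -/
theorem IsWeighting.lt_shadowCost (hw : IsWeighting w) (hT : 0 < T) (h : IsCutoff w T t₀)
    {s : ℝ} (hs : t₀ < s) : ENNReal.ofReal (Real.exp (-s)) < shadowCost w T t₀ s := by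
  have h0 := h.pos
  have hs0 : 0 < s := h0.trans hs
  have hu : t₀ ∈ Icc 0 T := ⟨h0.le, h.le⟩
  rw [hw.shadowCost_eq hT h hs0.le, min_eq_right hs.le,
    ENNReal.ofReal_lt_ofReal_iff_of_nonneg (Real.exp_pos _).le]
  set x := Real.exp (-s + t₀) with hx
  have hxm : x ∈ Ioo (0 : ℝ) 1 := by
    rw [hx, show -s + t₀ = -(s - t₀) by ring]
    exact exp_neg_mem_Ioo (by linarith)
  have herm : ∀ t < t₀, w (Real.exp (-t₀ + t)) * (2 * x - x ^ 2) +
      Real.exp (-t₀ + t) * deriv w (Real.exp (-t₀ + t)) * (x ^ 2 - x) <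
        w (Real.exp (-s + t)) := by
    intro t ht
    have hq : Real.exp (-t₀ + t) ∈ Ioo (0 : ℝ) 1 := by
      rw [show -t₀ + t = -(t₀ - t) by ring]
      exact exp_neg_mem_Ioo (by linarith)
    have h1 := hw.hermite_lt hq hxm
    rwa [hx, ← Real.exp_add, show -s + t₀ + (-t₀ + t) = -s + t by ring] at h1
  have i1 := hw.intervalIntegrable_mul_multiplier hT hu hs.le
  have i2 := hw.intervalIntegrable_mul_multiplier hT hu le_rfl
  obtain ⟨i3, e3⟩ := hw.integral_deriv_mul_multiplier hT h.1.1
  have e2 := (hw.isMultiplier_multiplier hT).2 t₀ hu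
  have hint : ∫ t in (0 : ℝ)..t₀, ((2 * x - x ^ 2) * (w (Real.exp (-t₀ + t)) * multiplier w T t) +
      (x ^ 2 - x) * (Real.exp (-t₀ + t) * deriv w (Real.exp (-t₀ + t)) * multiplier w T t)) ≤
      ∫ t in (0 : ℝ)..t₀, w (Real.exp (-s + t)) * multiplier w T t := by
    refine intervalIntegral.integral_mono_on_of_le_Ioo h0.le
      ((i2.const_mul _).add (i3.const_mul _)) i1 fun t ht => ?_
    have := mul_le_mul_of_nonneg_right (herm t ht.2).le (h.multiplier_pos ht).le
    linarith
  rw [intervalIntegral.integral_add (i2.const_mul _) (i3.const_mul _),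
    intervalIntegral.integral_const_mul, intervalIntegral.integral_const_mul] at hint
  -- The atom at time `0` supplies the strict inequality.
  have h4 := herm 0 h0
  simp only [add_zero] at h4
  have h5 : Real.exp (-s) = x * Real.exp (-t₀) := by
    rw [hx, ← Real.exp_add]; congr 1; ring
  have h6 := h.1.2
  have h7 : x ^ 2 - x < 0 := by nlinarith [hxm.1, hxm.2]
  have h8 : 0 ≤ (x ^ 2 - x) * multiplier w T t₀ := mul_nonneg_of_nonpos_of_nonpos h7.le h6
  have e2' : ∫ t in (0 : ℝ)..t₀, w (Real.exp (-t₀ + t)) * multiplier w T t =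
      Real.exp (-t₀) - w (Real.exp (-t₀)) := by linarith
  have e3' : ∫ t in (0 : ℝ)..t₀, Real.exp (-t₀ + t) * deriv w (Real.exp (-t₀ + t)) *
      multiplier w T t = multiplier w T t₀ + Real.exp (-t₀) -
        Real.exp (-t₀) * deriv w (Real.exp (-t₀)) := by linarith
  rw [e2', e3'] at hint
  linarith

theorem IsWeighting.measurable_load (hw : IsWeighting w) (μ : Measure ℝ) [SFinite μ] :
    Measurable (load w μ) := by
  have := hw.measurable_tail
  exact Measurable.lintegral_prod_right' (f := fun p : ℝ × ℝ => tail w (p.2 - p.1)) (by fun_prop)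

/-- By Tonelli, valuing payments at their shadow cost is the same as valuing loads at the
multipliers. -/
theorem IsWeighting.lintegral_shadowCost (hw : IsWeighting w) (hT : 0 < T) (μ : Measure ℝ)
    [SFinite μ] : ∫⁻ s, shadowCost w T t₀ s ∂μ = load w μ 0 +
      ∫⁻ t in Ioo 0 t₀, ENNReal.ofReal (multiplier w T t) * load w μ t := by
  have h1 := hw.measurable_tail
  have h2 := hw.measurable_multiplier hT
  simp only [shadowCost]
  rw [lintegral_add_left h1, lintegral_lintegral_swap (by fun_prop)]
  congr 1
  · simp [load]
  · refine lintegral_congr fun t => ?_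
    rw [load, lintegral_const_mul _ (by fun_prop)]

theorem IsWeighting.exp_neg_le_shadowCost (hw : IsWeighting w) (hT : 0 < T) (h : IsCutoff w T t₀)
    {s : ℝ} (hs : 0 ≤ s) : ENNReal.ofReal (Real.exp (-s)) ≤ shadowCost w T t₀ s := by
  rcases le_or_gt s t₀ with h1 | h1
  · exact (hw.shadowCost_of_le hT h ⟨hs, h1⟩).ge
  · exact (hw.lt_shadowCost hT h h1).le

theorem IsWeighting.lintegral_exp_neg_le_shadowCost (hw : IsWeighting w) (hT : 0 < T)
    (h : IsCutoff w T t₀) {μ : Measure ℝ} (hμ : ∀ᵐ s ∂μ, 0 ≤ s) :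
    ∫⁻ s, ENNReal.ofReal (Real.exp (-s)) ∂μ ≤ ∫⁻ s, shadowCost w T t₀ s ∂μ :=
  lintegral_mono_ae (hμ.mono fun _ hs => hw.exp_neg_le_shadowCost hT h hs)

theorem IsWeighting.lintegral_multiplier_mul (hw : IsWeighting w) (hT : 0 < T) {Θ : ℝ≥0∞} :
    Θ + ∫⁻ t in Ioo 0 t₀, ENNReal.ofReal (multiplier w T t) * Θ = Θ * shadowMass w T t₀ := by
  have h2 := hw.measurable_multiplier hT
  rw [lintegral_mul_const _ (by fun_prop), shadowMass, mul_add, mul_one, mul_comm Θ]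

section Duality

variable {μ : Measure ℝ} [SFinite μ] {Θ : ℝ≥0∞}

theorem IsWeighting.lintegral_shadowCost_le (hw : IsWeighting w) (hT : 0 < T)
    (hload : ∀ t, 0 ≤ t → load w μ t ≤ Θ) :
    ∫⁻ s, shadowCost w T t₀ s ∂μ ≤ Θ * shadowMass w T t₀ := by
  rw [hw.lintegral_shadowCost hT, ← hw.lintegral_multiplier_mul hT]
  refine add_le_add (hload 0 le_rfl) (setLIntegral_mono' measurableSet_Ioo fun t ht => ?_)
  gcongr
  exact hload t ht.1.le

/-- Weak duality. -/
theorem IsWeighting.lintegral_exp_neg_le (hw : IsWeighting w) (hT : 0 < T)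
    (h : IsCutoff w T t₀) (hμ : ∀ᵐ s ∂μ, 0 ≤ s) (hload : ∀ t, 0 ≤ t → load w μ t ≤ Θ) :
    ∫⁻ s, ENNReal.ofReal (Real.exp (-s)) ∂μ ≤ Θ * shadowMass w T t₀ :=
  (hw.lintegral_exp_neg_le_shadowCost hT h hμ).trans (hw.lintegral_shadowCost_le hT hload)

/-- Complementary slackness. -/
theorem IsWeighting.slackness (hw : IsWeighting w) (hT : 0 < T) (hΘ : Θ ≠ ∞)
    (h : IsCutoff w T t₀) (hμ : ∀ᵐ s ∂μ, 0 ≤ s) (hload : ∀ t, 0 ≤ t → load w μ t ≤ Θ)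
    (heq : ∫⁻ s, ENNReal.ofReal (Real.exp (-s)) ∂μ = Θ * shadowMass w T t₀) :
    μ (Ioi t₀) = 0 ∧ load w μ 0 = Θ ∧ ∀ᵐ t ∂volume.restrict (Ioo 0 t₀), load w μ t = Θ := by
  have hfin : Θ * shadowMass w T t₀ ≠ ∞ := ENNReal.mul_ne_top hΘ (hw.shadowMass_ne_top hT h)
  have hmm := hw.measurable_multiplier hT
  have hml := hw.measurable_load μ
  -- Both inequalities of weak duality become equalities between finite quantities. The strict cost
  -- beyond `t₀` then excludes mass there, and the positive multipliers force the load to bind.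
  have hcost : ∫⁻ s, shadowCost w T t₀ s ∂μ = Θ * shadowMass w T t₀ :=
    le_antisymm (hw.lintegral_shadowCost_le hT hload)
      (heq ▸ hw.lintegral_exp_neg_le_shadowCost hT h hμ)
  refine ⟨?_, ?_⟩
  · have hae := ae_eq_of_ae_le_of_lintegral_le
      (hμ.mono fun s hs => hw.exp_neg_le_shadowCost hT h hs) (heq ▸ hfin)
      (hw.measurable_shadowCost hT).aemeasurable (by rw [heq, hcost])
    refine measure_eq_zero_iff_ae_notMem.2 ?_
    filter_upwards [hae] with s hs hs'
    exact (hw.lt_shadowCost hT h hs').ne hs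
  · rw [hw.lintegral_shadowCost hT, ← hw.lintegral_multiplier_mul hT] at hcost
    rw [← hw.lintegral_multiplier_mul hT] at hfin
    have hle : ∀ᵐ t ∂volume.restrict (Ioo 0 t₀), ENNReal.ofReal (multiplier w T t) * load w μ t ≤
        ENNReal.ofReal (multiplier w T t) * Θ := by
      filter_upwards [ae_restrict_mem measurableSet_Ioo] with t ht
      gcongr
      exact hload t ht.1.le
    have hle' := lintegral_mono_ae hle
    have hfin2 := (ENNReal.add_ne_top.1 hfin).2
    have h0 : load w μ 0 = Θ := by
      refine le_antisymm (hload 0 le_rfl) ?_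
      refine (ENNReal.add_le_add_iff_right hfin2).1 ?_
      rw [← hcost]
      gcongr
    refine ⟨h0, ?_⟩
    rw [h0] at hcost
    have hint := (ENNReal.add_right_inj hΘ).1 hcost
    have hae := ae_eq_of_ae_le_of_lintegral_le hle (ne_top_of_le_ne_top hfin2 hle')
      (by fun_prop) hint.ge
    filter_upwards [hae, ae_restrict_mem measurableSet_Ioo] with t ht ht'
    exact (ENNReal.mul_right_inj (by simpa using h.multiplier_pos ht') ENNReal.ofReal_ne_top).1 ht

/-- A payment measure that binds up to `t₀` and vanishes afterwards attains the bound. -/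
theorem IsWeighting.lintegral_exp_neg_eq (hw : IsWeighting w) (hT : 0 < T)
    (h : IsCutoff w T t₀) (hμ : ∀ᵐ s ∂μ, s ∈ Icc 0 t₀)
    (hload : ∀ t ∈ Icc 0 t₀, load w μ t = Θ) :
    ∫⁻ s, ENNReal.ofReal (Real.exp (-s)) ∂μ = Θ * shadowMass w T t₀ := by
  have h1 : ∫⁻ s, ENNReal.ofReal (Real.exp (-s)) ∂μ = ∫⁻ s, shadowCost w T t₀ s ∂μ :=
    lintegral_congr_ae (hμ.mono fun s hs => (hw.shadowCost_of_le hT h hs).symm)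
  rw [h1, hw.lintegral_shadowCost hT, ← hw.lintegral_multiplier_mul hT,
    hload 0 ⟨le_rfl, h.pos.le⟩]
  congr 1
  refine setLIntegral_congr_fun measurableSet_Ioo fun t ht => ?_
  rw [hload t ⟨ht.1.le, ht.2.le⟩]

end Duality

end

/-! ### Survival functions of the total payment and their payment measures. -/

section

/-- A survival function: decreasing, right-continuous and with values in `[0, 1]`. -/
structure IsSurvival (G : ℝ → ℝ) : Prop where
  anti : Antitone G
  nonneg : ∀ y, 0 ≤ G y
  le_one : ∀ y, G y ≤ 1
  rightCont : ∀ y c, c < G y → ∃ z, y < z ∧ c < G z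

/-- The payment measure in exponential time that yields the total payment with survival function
`G`. -/
def paymentMeasure (G : ℝ → ℝ) : Measure ℝ :=
  (volume.restrict {y | 0 < y ∧ 0 < G y}).map fun y => -Real.log (G y)

variable {w : ℝ → ℝ} {T t₀ : ℝ} {G G' : ℝ → ℝ}

instance : SFinite (paymentMeasure G) := by unfold paymentMeasure; infer_instance

theorem IsSurvival.measurable (hG : IsSurvival G) : Measurable G := hG.anti.measurable

theorem IsSurvival.measurableSet_pos (hG : IsSurvival G) : MeasurableSet {y | 0 < y ∧ 0 < G y} :=
  (measurableSet_lt measurable_const measurable_id).inter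
    (measurableSet_lt measurable_const hG.measurable)

theorem IsSurvival.lintegral_paymentMeasure (hG : IsSurvival G) {φ : ℝ → ℝ≥0∞}
    (hφ : Measurable φ) : ∫⁻ s, φ s ∂paymentMeasure G =
      ∫⁻ y in {y | 0 < y ∧ 0 < G y}, φ (-Real.log (G y)) :=
  lintegral_map hφ (hG.measurable.log.neg)

theorem IsSurvival.ae_nonneg (hG : IsSurvival G) : ∀ᵐ s ∂paymentMeasure G, 0 ≤ s := by
  refine (ae_map_iff hG.measurable.log.neg.aemeasurable measurableSet_Ici).2 (ae_of_all _ fun y => ?_)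
  exact neg_nonneg.2 (Real.log_nonpos (hG.nonneg y) (hG.le_one y))

theorem IsSurvival.lintegral_exp_neg (hG : IsSurvival G) :
    ∫⁻ s, ENNReal.ofReal (Real.exp (-s)) ∂paymentMeasure G =
      ∫⁻ y in Ioi 0, ENNReal.ofReal (G y) := by
  rw [hG.lintegral_paymentMeasure (by fun_prop), ← lintegral_indicator hG.measurableSet_pos,
    ← lintegral_indicator measurableSet_Ioi]
  refine lintegral_congr fun y => ?_
  by_cases hy : y ∈ Ioi 0
  · rw [indicator_of_mem hy]
    rcases (hG.nonneg y).eq_or_lt with h | h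
    · rw [indicator_of_notMem (fun h' => h'.2.ne h), ← h, ENNReal.ofReal_zero]
    · rw [indicator_of_mem (show y ∈ {y | 0 < y ∧ 0 < G y} from ⟨hy, h⟩), neg_neg, Real.exp_log h]
  · rw [indicator_of_notMem hy, indicator_of_notMem (fun h => hy h.1)]

/-- At `s = -log (G y)` the integrand `w(e^{-(s - t)})` is `w(e^t G y)`, and `s ≥ t` means `G y ≤
e^{-t}`. Levels with `G y = 0` are harmless because `w 0 = 0`. -/
theorem IsSurvival.load_paymentMeasure (hG : IsSurvival G) (hw : IsWeighting w) (t : ℝ) :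
    load w (paymentMeasure G) t =
      ∫⁻ y in {y | 0 < y ∧ G y ≤ Real.exp (-t)}, ENNReal.ofReal (w (Real.exp t * G y)) := by
  have hm := hw.measurable_tail
  have hmeas : MeasurableSet {y | 0 < y ∧ G y ≤ Real.exp (-t)} :=
    (measurableSet_lt measurable_const measurable_id).inter
      (measurableSet_le hG.measurable measurable_const)
  rw [load, hG.lintegral_paymentMeasure (by fun_prop), ← lintegral_indicator hG.measurableSet_pos,
    ← lintegral_indicator hmeas]
  refine lintegral_congr fun y => ?_
  by_cases hy : 0 < y
  · rcases (hG.nonneg y).eq_or_lt with h | h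
    · rw [indicator_of_notMem (fun h' => h'.2.ne h),
        indicator_of_mem (show y ∈ {y | 0 < y ∧ G y ≤ Real.exp (-t)} from
          ⟨hy, h ▸ (Real.exp_pos _).le⟩), ← h, mul_zero, hw.zero, ENNReal.ofReal_zero]
    · rw [indicator_of_mem (show y ∈ {y | 0 < y ∧ 0 < G y} from ⟨hy, h⟩)]
      by_cases h2 : G y ≤ Real.exp (-t)
      · have h3 : 0 ≤ -Real.log (G y) - t := by
          have := Real.log_le_log h h2
          rw [Real.log_exp] at this
          linarith
        rw [indicator_of_mem (show y ∈ {y | 0 < y ∧ G y ≤ Real.exp (-t)} from ⟨hy, h2⟩),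
          tail_of_nonneg h3, neg_sub, sub_neg_eq_add, Real.exp_add, Real.exp_log h]
      · have h3 : -Real.log (G y) - t < 0 := by
          have := Real.log_lt_log (Real.exp_pos _) (not_le.1 h2)
          rw [Real.log_exp] at this
          linarith
        rw [indicator_of_notMem (fun h' => h2 h'.2), tail_of_neg h3]
  · rw [indicator_of_notMem (fun h => hy h.1), indicator_of_notMem (fun h => hy h.1)]

theorem IsSurvival.paymentMeasure_Iio (hG : IsSurvival G) (u : ℝ) :
    paymentMeasure G (Iio u) = volume {y | 0 < y ∧ Real.exp (-u) < G y} := by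
  have hlog : Measurable fun y => -Real.log (G y) := hG.measurable.log.neg
  rw [paymentMeasure, Measure.map_apply hlog measurableSet_Iio,
    Measure.restrict_apply (hlog measurableSet_Iio)]
  congr 1
  ext y
  simp only [mem_inter_iff, mem_preimage, mem_Iio, mem_ofPred_eq]
  constructor
  · rintro ⟨h1, h2, h3⟩
    exact ⟨h2, by rw [← Real.lt_log_iff_exp_lt h3]; linarith⟩
  · rintro ⟨h2, h3⟩
    have h4 := (Real.exp_pos (-u)).trans h3
    rw [← Real.lt_log_iff_exp_lt h4] at h3
    exact ⟨by linarith, h2, h4⟩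

/-- If `G y < e^{-u} < G' y`, the superlevel set of `G` has length at most `y`, while that of `G'`
is strictly longer by right-continuity. Equality on a dense set of `u` is enough to exclude this. -/
theorem IsSurvival.not_lt_of_volume_eq (hG : IsSurvival G) (hG' : IsSurvival G')
    (h : ∀ a b, 0 ≤ a → a < b → ∃ u ∈ Ioo a b,
      volume {y | 0 < y ∧ Real.exp (-u) < G y} = volume {y | 0 < y ∧ Real.exp (-u) < G' y})
    {y : ℝ} (hy : 0 ≤ y) : ¬ G y < G' y := by
  intro hlt
  have hpos : 0 < G' y := (hG.nonneg y).trans_lt hlt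
  obtain ⟨c, hc, hc'⟩ := exists_between hlt
  have hc0 : 0 < c := (hG.nonneg y).trans_lt hc
  obtain ⟨u, hu, hvol⟩ := h (-Real.log (G' y)) (-Real.log c)
    (neg_nonneg.2 (Real.log_nonpos hpos.le (hG'.le_one y)))
    (neg_lt_neg (Real.log_lt_log hc0 hc'))
  have h1 : G y < Real.exp (-u) := hc.trans (by rw [← Real.log_lt_iff_lt_exp hc0]; linarith [hu.2])
  have h2 : Real.exp (-u) < G' y := by rw [← Real.lt_log_iff_exp_lt hpos]; linarith [hu.1]
  obtain ⟨z, hz, hz'⟩ := hG'.rightCont y _ h2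
  have h3 : volume {y | 0 < y ∧ Real.exp (-u) < G y} ≤ ENNReal.ofReal y := by
    rw [← sub_zero y, ← Real.volume_Ioc]
    refine measure_mono fun v hv => ⟨hv.1, ?_⟩
    by_contra! hyv
    linarith [hG.anti hyv.le, hv.2]
  have h4 : ENNReal.ofReal z ≤ volume {y | 0 < y ∧ Real.exp (-u) < G' y} := by
    rw [← sub_zero z, ← Real.volume_Ioc]
    exact measure_mono fun v hv => ⟨hv.1, hz'.trans_le (hG'.anti hv.2)⟩
  have h5 := h4.trans (hvol ▸ h3)
  rw [ENNReal.ofReal_le_ofReal_iff hy] at h5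
  linarith

/-- Two survival functions that attain the bound of weak duality coincide. -/
theorem IsSurvival.eq_of_optimal (hG : IsSurvival G) (hG' : IsSurvival G') (hw : IsWeighting w)
    (hT : 0 < T) (h : IsCutoff w T t₀) {Θ : ℝ≥0∞} (hΘ : Θ ≠ ∞)
    (hl : ∀ t, 0 ≤ t → load w (paymentMeasure G) t ≤ Θ)
    (hl' : ∀ t, 0 ≤ t → load w (paymentMeasure G') t ≤ Θ)
    (hp : ∫⁻ y in Ioi 0, ENNReal.ofReal (G y) = Θ * shadowMass w T t₀)
    (hp' : ∫⁻ y in Ioi 0, ENNReal.ofReal (G' y) = Θ * shadowMass w T t₀) {y : ℝ} (hy : 0 ≤ y) :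
    G y = G' y := by
  have hfin : Θ * shadowMass w T t₀ ≠ ∞ := ENNReal.mul_ne_top hΘ (hw.shadowMass_ne_top hT h)
  rw [← hG.lintegral_exp_neg] at hp
  rw [← hG'.lintegral_exp_neg] at hp'
  obtain ⟨a1, a2, a3⟩ := hw.slackness hT hΘ h hG.ae_nonneg hl hp
  obtain ⟨b1, b2, b3⟩ := hw.slackness hT hΘ h hG'.ae_nonneg hl' hp'
  have hload : ∀ᵐ t ∂volume.restrict (Ioo 0 t₀),
      load w (paymentMeasure G) t = load w (paymentMeasure G') t := by
    filter_upwards [a3, b3] with t ha hb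
    rw [ha, hb]
  have hsub : ∀ t, 0 ≤ t → ∀ᵐ t ∂volume.restrict (Ioo t t₀),
      load w (paymentMeasure G) t = load w (paymentMeasure G') t :=
    fun t ht => ae_restrict_of_ae_restrict_of_subset (Ioo_subset_Ioo_left ht) hload
  have h0 : paymentMeasure G (Ici 0) = paymentMeasure G' (Ici 0) :=
    hw.measure_Ici_congr hT h.le a1 b1 le_rfl (a2.trans b2.symm) (hsub 0 le_rfl)
  -- Markov's inequality: on the support `e^{-s} ≥ e^{-t₀}`, and the integral of `e^{-s}` is finite.
  -- Finiteness permits passing from `Ici u` to `Iio u`.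
  have hfinite : paymentMeasure G (Ici 0) ≠ ∞ := by
    have h1 := mul_meas_ge_le_lintegral (μ := paymentMeasure G)
      (f := fun s => ENNReal.ofReal (Real.exp (-s))) (by fun_prop)
      (ENNReal.ofReal (Real.exp (-t₀)))
    rw [hp] at h1
    have h2 : paymentMeasure G (Ici 0) ≤ paymentMeasure G
        {s | ENNReal.ofReal (Real.exp (-t₀)) ≤ ENNReal.ofReal (Real.exp (-s))} := by
      refine measure_mono_ae ?_
      filter_upwards [measure_eq_zero_iff_ae_notMem.1 a1] with s hs _
      exact ENNReal.ofReal_le_ofReal (Real.exp_le_exp.2 (by simpa using hs))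
    intro htop
    rw [htop, top_le_iff] at h2
    rw [h2, ENNReal.mul_top (by simpa using Real.exp_pos _)] at h1
    exact hfin (top_le_iff.1 h1)
  have hIio : ∀ {H : ℝ → ℝ}, IsSurvival H → ∀ u, 0 ≤ u → paymentMeasure H (Iio u) +
      paymentMeasure H (Ici u) = paymentMeasure H (Ici 0) := by
    intro H hH u hu
    have hd : Disjoint (Iio u) (Ici u) := Set.disjoint_left.2 fun s h1 h2 => not_le.2 (mem_Iio.1 h1) (mem_Ici.1 h2)
    rw [← measure_union hd measurableSet_Ici, Iio_union_Ici]
    refine measure_congr ?_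
    filter_upwards [hH.ae_nonneg] with s hs
    exact propext ⟨fun _ => hs, fun _ => mem_univ s⟩
  have key : ∀ u, 0 ≤ u → paymentMeasure G (Ici u) = paymentMeasure G' (Ici u) →
      volume {y | 0 < y ∧ Real.exp (-u) < G y} = volume {y | 0 < y ∧ Real.exp (-u) < G' y} := by
    intro u hu he
    rw [← hG.paymentMeasure_Iio, ← hG'.paymentMeasure_Iio]
    have h1 := hIio hG u hu
    rw [h0, ← hIio hG' u hu, he] at h1
    refine (ENNReal.add_left_inj ?_).1 h1
    rw [← he]
    exact ne_top_of_le_ne_top hfinite (measure_mono (Ici_subset_Ici.2 hu))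
  -- Beyond `t₀` both measures vanish; before `t₀` the loads agree at almost every `u`, hence at
  -- some `u` in every interval.
  have hdense : ∀ a b, 0 ≤ a → a < b → ∃ u ∈ Ioo a b,
      volume {y | 0 < y ∧ Real.exp (-u) < G y} = volume {y | 0 < y ∧ Real.exp (-u) < G' y} := by
    intro a b ha hab
    rcases lt_or_ge t₀ b with hb | hb
    · obtain ⟨u, hu1, hu2⟩ := exists_between (max_lt hab hb)
      have hu : t₀ < u := (le_max_right _ _).trans_lt hu1
      refine ⟨u, ⟨(le_max_left _ _).trans_lt hu1, hu2⟩, key u (h.pos.trans hu).le ?_⟩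
      rw [measure_mono_null (Ici_subset_Ioi.2 hu) a1, measure_mono_null (Ici_subset_Ioi.2 hu) b1]
    · have hae := ae_restrict_of_ae_restrict_of_subset (Ioo_subset_Ioo ha hb) hload
      have : NeBot (ae (volume.restrict (Ioo a b))) := by
        rw [ae_neBot, Ne, Measure.restrict_eq_zero]
        simpa using hab
      obtain ⟨u, hu, hu'⟩ := (hae.and (ae_restrict_mem measurableSet_Ioo)).exists
      have hu0 : 0 ≤ u := ha.trans hu'.1.le
      exact ⟨u, hu', key u hu0 (hw.measure_Ici_congr hT h.le a1 b1 hu0 hu (hsub u hu0))⟩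
  refine le_antisymm ?_ ?_
  · exact not_lt.1 (hG'.not_lt_of_volume_eq hG (fun a b ha hab => by
      obtain ⟨u, hu, hu'⟩ := hdense a b ha hab
      exact ⟨u, hu, hu'.symm⟩) hy)
  · exact not_lt.1 (hG.not_lt_of_volume_eq hG' hdense hy)

end

/-! ### From pricing processes to the linear program. -/

section

variable {w wp wm : ℝ → ℝ} {θ lam : ℝ} {ν : Measure ℝ≥0∞} {T : ℝ≥0 → ℝ}

theorem IsPaymentFunction.nonneg (hT : IsPaymentFunction T) (t : ℝ≥0) : 0 ≤ T t :=
  hT.zero ▸ hT.mono (zero_le (a := t))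

theorem totalPayment_coe (T : ℝ≥0 → ℝ) (t : ℝ≥0) : totalPayment T t = ENNReal.ofReal (T t) := by
  simp [totalPayment]

theorem totalPayment_top (T : ℝ≥0 → ℝ) : totalPayment T ∞ = ⨆ t : ℝ≥0, ENNReal.ofReal (T t) := by
  simp [totalPayment]

theorem IsPaymentFunction.totalPayment_mono (hT : IsPaymentFunction T) :
    Monotone (totalPayment T) := by
  intro a b hab
  induction b with
  | top =>
    induction a with
    | top => exact le_rfl
    | coe a =>
      rw [totalPayment_coe, totalPayment_top]
      exact le_iSup (fun t => ENNReal.ofReal (T t)) a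
  | coe b =>
    induction a with
    | top => simp at hab
    | coe a =>
      rw [totalPayment_coe, totalPayment_coe]
      exact ENNReal.ofReal_le_ofReal (hT.mono (by exact_mod_cast hab))

theorem IsPaymentFunction.measurable_totalPayment (hT : IsPaymentFunction T) :
    Measurable (totalPayment T) := hT.totalPayment_mono.measurable

/-- The probability that the total payment exceeds `y`. -/
def paymentSurvival (ν : Measure ℝ≥0∞) (T : ℝ≥0 → ℝ) (y : ℝ) : ℝ :=
  ν.real {a | ENNReal.ofReal y < totalPayment T a}

theorem IsPaymentFunction.measurableSet_lt_totalPayment (hT : IsPaymentFunction T) (c : ℝ≥0∞) :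
    MeasurableSet {a | c < totalPayment T a} :=
  measurableSet_lt measurable_const hT.measurable_totalPayment

theorem isSurvival_paymentSurvival (ν : Measure ℝ≥0∞) [IsProbabilityMeasure ν] (T : ℝ≥0 → ℝ) :
    IsSurvival (paymentSurvival ν T) where
  anti := fun x y hxy => measureReal_mono fun a ha => (ENNReal.ofReal_le_ofReal hxy).trans_lt ha
  nonneg := fun y => measureReal_nonneg
  le_one := fun y => measureReal_le_one
  rightCont := fun y c hc => by
    have hU : {a | ENNReal.ofReal y < totalPayment T a} =
        ⋃ n : ℕ, {a | ENNReal.ofReal (y + 1 / (n + 1)) < totalPayment T a} := by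
      ext a
      simp only [mem_ofPred_eq, mem_iUnion]
      constructor
      · intro h
        have hlim : Tendsto (fun n : ℕ => ENNReal.ofReal (y + 1 / (n + 1))) atTop
            (𝓝 (ENNReal.ofReal y)) := by
          refine ENNReal.tendsto_ofReal ?_
          simpa using tendsto_one_div_add_atTop_nhds_zero_nat.const_add y
        exact (hlim.eventually_lt_const h).exists
      · rintro ⟨n, hn⟩
        refine lt_of_le_of_lt (ENNReal.ofReal_le_ofReal ?_) hn
        have : (0 : ℝ) < 1 / (n + 1) := Nat.one_div_pos_of_nat
        linarith
    have hmono : Monotone fun n : ℕ => {a | ENNReal.ofReal (y + 1 / (n + 1)) < totalPayment T a} := by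
      intro m n hmn a ha
      refine lt_of_le_of_lt (ENNReal.ofReal_le_ofReal ?_) ha
      have := Nat.one_div_le_one_div (α := ℝ) hmn
      linarith
    have hlim := tendsto_measure_iUnion_atTop (μ := ν) hmono
    rw [← hU] at hlim
    have hlim' := (ENNReal.tendsto_toReal (measure_ne_top ν _)).comp hlim
    obtain ⟨n, hn⟩ := (hlim'.eventually_const_lt hc).exists
    exact ⟨y + 1 / (n + 1), by linarith [(Nat.one_div_pos_of_nat : (0 : ℝ) < 1 / ((n : ℝ) + 1))], hn⟩

theorem profit_eq [IsProbabilityMeasure ν] :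
    profit ν T = ∫⁻ y in Ioi 0, ENNReal.ofReal (paymentSurvival ν T y) :=
  lintegral_congr fun _ => (ofReal_measureReal (measure_ne_top _ _)).symm

theorem condLaw_real [IsProbabilityMeasure ν] (s : ℝ≥0) (A : Set ℝ≥0∞) :
    (condLaw ν s).real A =
      ν.real ({a | (s : ℝ≥0∞) < a} ∩ A) / ν.real {a | (s : ℝ≥0∞) < a} := by
  have hm : MeasurableSet {a : ℝ≥0∞ | (s : ℝ≥0∞) < a} := measurableSet_Ioi
  rw [condLaw, Measure.real, ProbabilityTheory.cond_apply hm, ENNReal.toReal_mul,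
    ENNReal.toReal_inv, div_eq_inv_mul]
  rfl

theorem IsPaymentFunction.lt_of_lt_totalPayment (hT : IsPaymentFunction T) {s : ℝ≥0} {y : ℝ}
    (hy : T s ≤ y) {a : ℝ≥0∞} (ha : ENNReal.ofReal y < totalPayment T a) : (s : ℝ≥0∞) < a := by
  by_contra! h
  have h1 := hT.totalPayment_mono h
  rw [totalPayment_coe] at h1
  exact absurd (ha.trans_le h1) (not_lt.2 (ENNReal.ofReal_le_ofReal hy))

/-- The perceived remaining payment in terms of the survival function of the total payment. -/
theorem IsPaymentFunction.perceivedPayment_eq (hT : IsPaymentFunction T) [IsProbabilityMeasure ν]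
    (w : ℝ → ℝ) (s : ℝ≥0) : perceivedPayment w ν T s = ∫⁻ y in Ioi (T s),
      ENNReal.ofReal (w (paymentSurvival ν T y / ν.real {a | (s : ℝ≥0∞) < a})) := by
  have h1 : perceivedPayment w ν T s = ∫⁻ y in Ioi (0 : ℝ), ENNReal.ofReal
      (w (paymentSurvival ν T (y + T s) / ν.real {a | (s : ℝ≥0∞) < a})) := by
    refine setLIntegral_congr_fun measurableSet_Ioi fun y hy => ?_
    have hset : {a | ENNReal.ofReal y < totalPayment T a - ENNReal.ofReal (T s)} =
        {a | ENNReal.ofReal (y + T s) < totalPayment T a} := by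
      ext a
      rw [mem_ofPred_eq, mem_ofPred_eq, lt_tsub_iff_right,
        ENNReal.ofReal_add (le_of_lt hy) (hT.nonneg s)]
    have hsub : {a | (s : ℝ≥0∞) < a} ∩ {a | ENNReal.ofReal (y + T s) < totalPayment T a} =
        {a | ENNReal.ofReal (y + T s) < totalPayment T a} :=
      inter_eq_right.2 fun a ha => hT.lt_of_lt_totalPayment
        (by linarith [show (0 : ℝ) < y from hy]) ha
    rw [condLaw_real, hset, hsub, paymentSurvival]
  rw [h1, ← lintegral_indicator measurableSet_Ioi, ← lintegral_indicator measurableSet_Ioi,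
    ← lintegral_add_right_eq_self (indicator (Ioi (T s)) _) (T s)]
  refine lintegral_congr fun y => ?_
  by_cases hy : 0 < y
  · rw [indicator_of_mem (mem_Ioi.2 hy), indicator_of_mem (mem_Ioi.2 (by linarith))]
  · rw [indicator_of_notMem (by simpa using hy), indicator_of_notMem (by simpa using hy)]

/-- Take `e^{-t} = P(τ > s)`. Every level `y > T s` satisfies `G y ≤ P(τ > s)`, since exceeding it
requires `τ > s`. -/
theorem IsPaymentFunction.perceivedPayment_le_load (hT : IsPaymentFunction T)
    [IsProbabilityMeasure ν] (hw : IsWeighting w) {s : ℝ≥0} (hs : 0 < ν {a | (s : ℝ≥0∞) < a}) :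
    ∃ t, 0 ≤ t ∧ perceivedPayment w ν T s ≤ load w (paymentMeasure (paymentSurvival ν T)) t := by
  set q := ν.real {a | (s : ℝ≥0∞) < a} with hq
  have hq0 : 0 < q := ENNReal.toReal_pos hs.ne' (measure_ne_top _ _)
  refine ⟨-Real.log q, neg_nonneg.2 (Real.log_nonpos hq0.le measureReal_le_one), ?_⟩
  rw [hT.perceivedPayment_eq, (isSurvival_paymentSurvival ν T).load_paymentMeasure hw, neg_neg, Real.exp_neg,
    Real.exp_log hq0]
  simp only [← div_eq_inv_mul]
  refine lintegral_mono_set fun y hy => ⟨(hT.nonneg s).trans_lt hy, ?_⟩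
  exact measureReal_mono fun a ha => hT.lt_of_lt_totalPayment (le_of_lt hy) ha

theorem ofReal_mul_le_iff (hlam : 0 < lam) {x : ℝ≥0∞} {c : ℝ} :
    ENNReal.ofReal lam * x ≤ ENNReal.ofReal c ↔ x ≤ ENNReal.ofReal (c / lam) := by
  rw [ENNReal.ofReal_div_of_pos hlam, ENNReal.le_div_iff_mul_le
    (Or.inl (by simpa using hlam)) (Or.inl ENNReal.ofReal_ne_top), mul_comm]

theorem IsPaymentFunction.dir_of_load_le (hT : IsPaymentFunction T) [IsProbabilityMeasure ν]
    (hwp : IsWeighting wp) (hwm : IsWeighting wm) (hlam : 0 < lam) (hν : ν {a | a < ∞} = 1)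
    (hl : ∀ t, 0 ≤ t →
      load wm (paymentMeasure (paymentSurvival ν T)) t ≤ ENNReal.ofReal (θ / lam)) :
    DIR wp wm θ lam ν T := by
  intro s hs
  have h1 : (condLaw ν s).real {a | a < ∞} = 1 := by
    have hms : MeasurableSet {a : ℝ≥0∞ | a < ∞} := measurableSet_Iio
    have hae : ∀ᵐ a ∂ν, a < ∞ := (prob_compl_eq_zero_iff hms).2 hν
    have h2 : ν.real ({a | (s : ℝ≥0∞) < a} ∩ {a | a < ∞}) = ν.real {a | (s : ℝ≥0∞) < a} := by
      refine measureReal_congr ?_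
      filter_upwards [hae] with a ha
      exact propext ⟨fun h => h.1, fun h => ⟨h, ha⟩⟩
    rw [condLaw_real, h2, div_self]
    exact (ENNReal.toReal_pos hs.ne' (measure_ne_top _ _)).ne'
  rw [h1, hwp.one, mul_one, ofReal_mul_le_iff hlam]
  obtain ⟨t, ht, hle⟩ := hT.perceivedPayment_le_load hwm hs
  exact hle.trans (hl t ht)

/-- Every event that the total payment exceeds a level is the event that the good has not been
obtained until some time. -/
theorem IsPaymentFunction.exists_threshold (hT : IsPaymentFunction T) {x : ℝ} (hx : 0 ≤ x)
    (hne : ∃ a, ENNReal.ofReal x < totalPayment T a) :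
    ∃ s : ℝ≥0, T s ≤ x ∧ {a | (s : ℝ≥0∞) < a} = {a | ENNReal.ofReal x < totalPayment T a} := by
  have hex : ∃ t : ℝ≥0, x < T t := by
    obtain ⟨a, ha⟩ := hne
    induction a with
    | top =>
      rw [totalPayment_top] at ha
      obtain ⟨t, ht⟩ := lt_iSup_iff.1 ha
      exact ⟨t, (ENNReal.ofReal_lt_ofReal_iff_of_nonneg hx).1 ht⟩
    | coe t =>
      rw [totalPayment_coe] at ha
      exact ⟨t, (ENNReal.ofReal_lt_ofReal_iff_of_nonneg hx).1 ha⟩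
  obtain ⟨t, ht⟩ := hex
  -- The threshold is `sSup A`; left-continuity of `T` puts it in `A`, so exceeding `x` is exactly
  -- being later than it.
  set A : Set ℝ≥0 := {s | T s ≤ x} with hA
  have hbdd : BddAbove A := ⟨t, fun s hs => by
    by_contra! h
    exact absurd (hT.mono h.le) (not_le.2 (lt_of_le_of_lt hs ht))⟩
  have hA0 : A.Nonempty := ⟨0, by simpa [hA, hT.zero] using hx⟩
  have hmem : T (sSup A) ≤ x := by
    by_contra! h
    have hev := (hT.leftCont (sSup A)).eventually (lt_mem_nhds h)
    obtain ⟨s, hs, hs'⟩ : ∃ s ∈ A, x < T s := by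
      have := (isLUB_csSup hA0 hbdd).frequently_mem hA0
      exact (this.and_eventually hev).exists
    exact absurd hs (not_le.2 hs')
  refine ⟨sSup A, hmem, ?_⟩
  ext a
  refine ⟨fun h => ?_, fun h => hT.lt_of_lt_totalPayment hmem h⟩
  have key : ∀ b : ℝ≥0, sSup A < b → x < T b := fun b hb => by
    by_contra! hle
    exact absurd (le_csSup hbdd hle) (not_le.2 hb)
  obtain ⟨b, hb, hb'⟩ := ENNReal.lt_iff_exists_nnreal_btwn.1 h
  have h1 := hT.totalPayment_mono hb'.le
  rw [totalPayment_coe] at h1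
  refine lt_of_lt_of_le ?_ h1
  exact (ENNReal.ofReal_lt_ofReal_iff_of_nonneg hx).2 (key b (by exact_mod_cast hb))

/-- A clock time `t` need not match a value of `P(τ > s)`. The lowest level `x` with `G x ≤ e^{-t}`
does correspond to some `s` with `P(τ > s) = G x`, and DIR at this `s` is at least as strong,
because `e^t ≤ 1 / G x` and `w` increases. -/
theorem IsPaymentFunction.load_le_of_dir (hT : IsPaymentFunction T) [IsProbabilityMeasure ν]
    (hwp : IsWeighting wp) (hwm : IsWeighting wm) (hθ : 0 < θ) (hlam : 0 < lam)
    (hdir : DIR wp wm θ lam ν T) (t : ℝ) :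
    load wm (paymentMeasure (paymentSurvival ν T)) t ≤ ENNReal.ofReal (θ / lam) := by
  have hG := isSurvival_paymentSurvival ν T
  set G := paymentSurvival ν T with hGdef
  rw [hG.load_paymentMeasure hwm]
  set Y : Set ℝ := {y | 0 < y ∧ G y ≤ Real.exp (-t)} with hY
  have hYm : MeasurableSet Y := (measurableSet_lt measurable_const measurable_id).inter
    (measurableSet_le hG.measurable measurable_const)
  by_cases hpos : ∃ y ∈ Y, 0 < G y
  swap
  · push Not at hpos
    have : ∫⁻ y in Y, ENNReal.ofReal (wm (Real.exp t * G y)) = 0 := by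
      rw [setLIntegral_congr_fun (g := fun _ => 0) hYm fun y hy => ?_]
      · simp
      · rw [le_antisymm (hpos y hy) (hG.nonneg y), mul_zero, hwm.zero, ENNReal.ofReal_zero]
    rw [this]
    exact zero_le
  obtain ⟨y₁, hy₁, hy₁'⟩ := hpos
  have hbdd : BddBelow Y := ⟨0, fun y hy => hy.1.le⟩
  set x := sInf Y with hx
  have hx0 : 0 ≤ x := le_csInf ⟨y₁, hy₁⟩ fun y hy => hy.1.le
  -- Right-continuity of `G` makes the infimum attain the bound, also when `x = 0` is not in `Y`.
  have hGx : G x ≤ Real.exp (-t) := by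
    by_contra! h
    obtain ⟨z, hz, hz'⟩ := hG.rightCont x _ h
    obtain ⟨y, hy, hyz⟩ := exists_lt_of_csInf_lt ⟨y₁, hy₁⟩ hz
    linarith [hG.anti hyz.le, hy.2]
  have hGx0 : 0 < G x := hy₁'.trans_le (hG.anti (csInf_le hbdd hy₁))
  obtain ⟨s, hs, hset⟩ := hT.exists_threshold hx0 (by
    by_contra! hempty
    have h0 : {a | ENNReal.ofReal x < totalPayment T a} = ∅ :=
      eq_empty_of_forall_notMem fun a ha => not_lt.2 (hempty a) ha
    rw [hGdef, paymentSurvival, h0, measureReal_empty] at hGx0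
    exact lt_irrefl _ hGx0)
  have hreal : ν.real {a | (s : ℝ≥0∞) < a} = G x := by rw [hset]; rfl
  have hd := hdir s (pos_iff_ne_zero.2 fun h0 => by
    rw [Measure.real, h0, ENNReal.toReal_zero] at hreal
    exact hGx0.ne hreal)
  have hle : θ * wp ((condLaw ν s).real {a | a < ∞}) ≤ θ := by
    have : (condLaw ν s).real {a | a < ∞} ∈ Icc (0 : ℝ) 1 := by
      refine ⟨measureReal_nonneg, ?_⟩
      rw [condLaw_real]
      exact div_le_one_of_le₀ (measureReal_mono inter_subset_left) measureReal_nonneg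
    exact mul_le_of_le_one_right hθ.le (hwp.le_one this)
  have hd2 := (ofReal_mul_le_iff hlam).1 (hd.trans (ENNReal.ofReal_le_ofReal hle))
  rw [hT.perceivedPayment_eq, hreal, ← hGdef] at hd2
  refine le_trans ?_ hd2
  have hYsub : Y ⊆ Ici x := fun y hy => csInf_le hbdd hy
  calc ∫⁻ y in Y, ENNReal.ofReal (wm (Real.exp t * G y))
      ≤ ∫⁻ y in Y, ENNReal.ofReal (wm (G y / G x)) := by
        refine setLIntegral_mono' hYm fun y hy => ENNReal.ofReal_le_ofReal ?_
        have h1 : Real.exp t ≤ (G x)⁻¹ := by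
          rw [le_inv_comm₀ (Real.exp_pos t) hGx0, ← Real.exp_neg]; exact hGx
        have h2 : Real.exp t * G y ≤ G y / G x := by
          rw [div_eq_inv_mul]; exact mul_le_mul_of_nonneg_right h1 (hG.nonneg y)
        have h3 : G y / G x ≤ 1 := (div_le_one hGx0).2 (hG.anti (hYsub hy))
        have h4 : 0 ≤ Real.exp t * G y := mul_nonneg (Real.exp_pos t).le (hG.nonneg y)
        exact hwm.strictMono.monotoneOn ⟨h4, h2.trans h3⟩ ⟨h4.trans h2, h3⟩ h2
    _ ≤ ∫⁻ y in Ici x, ENNReal.ofReal (wm (G y / G x)) := lintegral_mono_set hYsub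
    _ = ∫⁻ y in Ioi x, ENNReal.ofReal (wm (G y / G x)) := setLIntegral_congr Ioi_ae_eq_Ici.symm
    _ ≤ ∫⁻ y in Ioi (T s), ENNReal.ofReal (wm (G y / G x)) :=
        lintegral_mono_set (Ioi_subset_Ioi hs)

/-- If the good is possibly never obtained, the initial constraint is slack. -/
theorem IsPaymentFunction.load_zero_lt (hT : IsPaymentFunction T) [IsProbabilityMeasure ν]
    (hwp : IsWeighting wp) (hwm : IsWeighting wm) (hθ : 0 < θ) (hlam : 0 < lam)
    (hdir : DIR wp wm θ lam ν T) (hν : ν {a | a < ∞} ≠ 1) :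
    load wm (paymentMeasure (paymentSurvival ν T)) 0 < ENNReal.ofReal (θ / lam) := by
  have hG := isSurvival_paymentSurvival ν T
  set A : Set ℝ≥0∞ := {a | ((0 : ℝ≥0) : ℝ≥0∞) < a} with hA
  have hms : MeasurableSet {a : ℝ≥0∞ | a < ∞} := measurableSet_Iio
  have htop : 0 < ν {a : ℝ≥0∞ | a < ∞}ᶜ :=
    pos_iff_ne_zero.2 fun h => hν ((prob_compl_eq_zero_iff hms).1 h)
  have hsub : {a : ℝ≥0∞ | a < ∞}ᶜ ⊆ A := fun a ha => by
    have : a = ∞ := by simpa using ha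
    simp [hA, this]
  have hApos : 0 < ν A := htop.trans_le (measure_mono hsub)
  set q := ν.real A with hq
  have hq0 : 0 < q := ENNReal.toReal_pos hApos.ne' (measure_ne_top _ _)
  -- The event `τ = ∞` lies inside `τ > 0`, so conditioning keeps its probability positive, and `w₊`
  -- is then strictly below `1`.
  have hr : (condLaw ν 0).real {a | a < ∞} < 1 := by
    rw [condLaw_real, div_lt_one hq0]
    have h1 := measureReal_inter_add_sdiff (μ := ν) (s := A) hms
    have h2 : {a : ℝ≥0∞ | a < ∞}ᶜ ⊆ A \ {a | a < ∞} := fun a ha => ⟨hsub ha, ha⟩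
    have h3 : 0 < ν.real (A \ {a | a < ∞}) :=
      ENNReal.toReal_pos (htop.trans_le (measure_mono h2)).ne' (measure_ne_top _ _)
    linarith
  have hd := (ofReal_mul_le_iff hlam).1 (hdir 0 hApos)
  have hlt : ENNReal.ofReal (θ * wp ((condLaw ν 0).real {a | a < ∞}) / lam) <
      ENNReal.ofReal (θ / lam) := by
    rw [ENNReal.ofReal_lt_ofReal_iff (div_pos hθ hlam)]
    refine div_lt_div_of_pos_right (mul_lt_of_lt_one_right hθ ?_) hlam
    have := hwp.strictMono ⟨measureReal_nonneg, hr.le⟩ (by simp) hr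
    rwa [hwp.one] at this
  refine lt_of_le_of_lt (le_trans ?_ hd) hlt
  rw [hT.perceivedPayment_eq, hT.zero, hG.load_paymentMeasure hwm]
  simp only [Real.exp_zero, neg_zero, one_mul]
  refine (lintegral_mono_set (t := Ioi 0) fun y hy => hy.1).trans ?_
  refine setLIntegral_mono' measurableSet_Ioi fun y hy => ENNReal.ofReal_le_ofReal ?_
  have h0 : paymentSurvival ν T y ≤ q := measureReal_mono fun a ha =>
    hT.lt_of_lt_totalPayment (by rw [hT.zero]; exact le_of_lt hy) ha
  have h1 : paymentSurvival ν T y ≤ paymentSurvival ν T y / q :=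
    le_div_self (hG.nonneg y) hq0 measureReal_le_one
  have h2 : paymentSurvival ν T y / q ≤ 1 := (div_le_one hq0).2 h0
  exact hwm.strictMono.monotoneOn ⟨hG.nonneg y, h1.trans h2⟩ ⟨(hG.nonneg y).trans h1, h2⟩ h1

end

/-! ### The exponential time and the optimal payment function. -/

section

variable {w wp wm : ℝ → ℝ} {θ lam Θ t₀ : ℝ} {T : ℝ≥0 → ℝ} {f : ℝ → ℝ}

instance : IsProbabilityMeasure (ProbabilityTheory.expMeasure 1) :=
  ProbabilityTheory.isProbabilityMeasure_expMeasure one_pos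

instance : IsProbabilityMeasure expTime :=
  Measure.isProbabilityMeasure_map ENNReal.measurable_ofReal.aemeasurable

theorem expTime_Iic (t : ℝ≥0) :
    expTime (Iic (t : ℝ≥0∞)) = ENNReal.ofReal (1 - Real.exp (-t)) := by
  have h1 : ENNReal.ofReal ⁻¹' Iic (t : ℝ≥0∞) = Iic (t : ℝ) := by
    ext x
    rw [mem_preimage, mem_Iic, mem_Iic, ENNReal.ofReal_le_coe]
  rw [expTime, Measure.map_apply ENNReal.measurable_ofReal measurableSet_Iic, h1,
    ← ofReal_measureReal, ← ProbabilityTheory.cdf_eq_real,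
    ProbabilityTheory.cdf_expMeasure_eq one_pos, if_pos t.coe_nonneg, one_mul]

theorem expTime_real_Ioi (t : ℝ≥0) : expTime.real {a | (t : ℝ≥0∞) < a} = Real.exp (-t) := by
  have h1 : {a : ℝ≥0∞ | (t : ℝ≥0∞) < a} = (Iic (t : ℝ≥0∞))ᶜ := by ext; simp
  rw [h1, probReal_compl_eq_one_sub measurableSet_Iic, Measure.real, expTime_Iic,
    ENNReal.toReal_ofReal (sub_nonneg.2 (exp_neg_mem_Icc t.coe_nonneg).2)]
  ring

theorem expTime_lt_top : expTime {a | a < ∞} = 1 := by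
  have hms : MeasurableSet {a : ℝ≥0∞ | a < ∞} := measurableSet_Iio
  rw [expTime, Measure.map_apply ENNReal.measurable_ofReal hms]
  simp

theorem isTimeLaw_expTime : IsTimeLaw expTime where
  prob := inferInstance
  regular := by
    refine ⟨fun s => Real.toNNReal (Real.exp (-s)), 0, 0, by fun_prop, fun t => ?_⟩
    rw [expTime_Iic, ← lintegral_exp_neg t.coe_nonneg, setLIntegral_congr Ioo_ae_eq_Icc]
    simp [ENNReal.ofReal]

/-- In exponential time the payment function is the distribution function of the payment
measure. -/
theorem IsPaymentFunction.paymentMeasure_expTime_Iio (hT : IsPaymentFunction T) (u : ℝ≥0) :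
    paymentMeasure (paymentSurvival expTime T) (Iio (u : ℝ)) = ENNReal.ofReal (T u) := by
  rw [(isSurvival_paymentSurvival expTime T).paymentMeasure_Iio]
  have hset : {y | 0 < y ∧ Real.exp (-u) < paymentSurvival expTime T y} = Ioo 0 (T u) := by
    ext y
    refine and_congr_right fun hy => ⟨fun h => ?_, fun h => ?_⟩
    · by_contra! hle
      have h1 : paymentSurvival expTime T y ≤ expTime.real {a | (u : ℝ≥0∞) < a} :=
        measureReal_mono fun a ha => hT.lt_of_lt_totalPayment hle ha
      rw [expTime_real_Ioi] at h1
      linarith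
    · have hu : 0 < u := by
        rw [pos_iff_ne_zero]
        rintro rfl
        rw [hT.zero] at h
        linarith
      have hev := (hT.leftCont u).eventually (lt_mem_nhds h)
      have : NeBot (𝓝[<] u) := nhdsLT_neBot_of_exists_lt ⟨0, hu⟩
      obtain ⟨v, hv, hvu⟩ := ((hev.filter_mono (nhdsWithin_mono u Iio_subset_Iic_self)).and
        self_mem_nhdsWithin).exists
      have h1 : expTime.real {a | (v : ℝ≥0∞) < a} ≤ paymentSurvival expTime T y := by
        refine measureReal_mono fun a ha => ?_
        have h2 := hT.totalPayment_mono (le_of_lt ha)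
        rw [totalPayment_coe] at h2
        exact lt_of_lt_of_le ((ENNReal.ofReal_lt_ofReal_iff_of_nonneg hy.le).2 hv) h2
      rw [expTime_real_Ioi] at h1
      refine lt_of_lt_of_le (Real.exp_lt_exp.2 (neg_lt_neg ?_)) h1
      exact_mod_cast hvu
  rw [hset, Real.volume_Ioo, sub_zero]

section Optimal

/-- The flow payment `Θ * f` on `[0, t₀]` followed by the lump sum `Θ` at time `t₀`. -/
def flowMeasure (Θ t₀ : ℝ) (f : ℝ → ℝ) : Measure ℝ :=
  ENNReal.ofReal Θ • ((volume.restrict (Icc 0 t₀)).withDensity (fun s => ENNReal.ofReal (f s)) +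
    Measure.dirac t₀)

instance : SFinite (flowMeasure Θ t₀ f) := by
  unfold flowMeasure
  infer_instance

theorem ae_flowMeasure (ht₀ : 0 < t₀) : ∀ᵐ s ∂flowMeasure Θ t₀ f, s ∈ Icc 0 t₀ := by
  refine Measure.ae_smul_measure ?_ _
  rw [ae_add_measure_iff]
  refine ⟨(withDensity_absolutelyContinuous _ _).ae_le (ae_restrict_mem measurableSet_Icc), ?_⟩
  exact (ae_dirac_iff (p := (· ∈ Icc 0 t₀)) measurableSet_Icc).2 ⟨ht₀.le, le_rfl⟩

/-- The flow contributes the integral and the lump sum the first term of the binding equation, both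
scaled by `Θ`. -/
theorem IsWeighting.load_flowMeasure (hw : IsWeighting w) (hf : IsBindingFlow w t₀ f)
    (hf0 : ∀ s, 0 ≤ f s) {t : ℝ} (ht : t ∈ Icc 0 t₀) :
    load w (flowMeasure Θ t₀ f) t = ENNReal.ofReal Θ := by
  have hm := hw.measurable_tail
  have hi := hw.intervalIntegrable_mul ht hf.1
  rw [intervalIntegrable_iff_integrableOn_Ioc_of_le ht.2] at hi
  have h0 : 0 ≤ t₀ - t := sub_nonneg.2 ht.2
  have hae : 0 ≤ᵐ[volume.restrict (Ioc t t₀)] fun s => w (Real.exp (-s + t)) * f s := by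
    filter_upwards [ae_restrict_mem measurableSet_Ioc] with s hs
    rw [show -s + t = -(s - t) by ring]
    exact mul_nonneg (hw.nonneg (exp_neg_mem_Icc (by linarith [hs.1]))) (hf0 s)
  have hld := hw.load_withDensity ht hf.1
  rw [load] at hld
  rw [load, flowMeasure, lintegral_smul_measure, lintegral_add_measure,
    lintegral_dirac' _ (by fun_prop), hld, tail_of_nonneg h0,
    ← ofReal_integral_eq_lintegral_ofReal hi hae, ← ENNReal.ofReal_add
      (integral_nonneg_of_ae hae) (hw.nonneg (exp_neg_mem_Icc h0)),
    ← intervalIntegral.integral_of_le ht.2, add_comm, neg_sub, sub_eq_neg_add, hf.2 t ht]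
  simp

theorem load_flowMeasure_of_lt (ht₀ : 0 < t₀) {t : ℝ} (ht : t₀ < t) :
    load w (flowMeasure Θ t₀ f) t = 0 := by
  refine load_eq_zero (S := t₀) ?_ ht
  rw [measure_eq_zero_iff_ae_notMem]
  filter_upwards [ae_flowMeasure ht₀] with s hs
  exact not_lt.2 hs.2

theorem intervalIntegrable_of_isBindingFlow (hf : IsBindingFlow w t₀ f) {a b : ℝ}
    (ha : a ∈ Icc 0 t₀) (hb : b ∈ Icc 0 t₀) : IntervalIntegrable f volume a b :=
  (hf.1.mono_set (uIcc_subset_Icc ha hb)).intervalIntegrable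

theorem optimalPayment_nonneg_integral (hf0 : ∀ s, 0 ≤ f s) (ht₀ : 0 < t₀) (u : ℝ≥0) :
    0 ≤ ∫ s in (0 : ℝ)..min (u : ℝ) t₀, f s :=
  intervalIntegral.integral_nonneg (le_min u.coe_nonneg ht₀.le) fun s _ => hf0 s

theorem flowMeasure_Iio (hΘ : 0 ≤ Θ) (hf : IsBindingFlow w t₀ f) (hf0 : ∀ s, 0 ≤ f s)
    (ht₀ : 0 < t₀) (u : ℝ≥0) : flowMeasure Θ t₀ f (Iio (u : ℝ)) =
      ENNReal.ofReal (Θ * ((if t₀ < (u : ℝ) then 1 else 0) +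
        ∫ s in (0 : ℝ)..min (u : ℝ) t₀, f s)) := by
  have hm : min (u : ℝ) t₀ ∈ Icc 0 t₀ := ⟨le_min u.coe_nonneg ht₀.le, min_le_right _ _⟩
  have hi := intervalIntegrable_of_isBindingFlow hf ⟨le_rfl, ht₀.le⟩ hm
  rw [intervalIntegrable_iff_integrableOn_Ioc_of_le hm.1] at hi
  have h1 : ((volume.restrict (Icc 0 t₀)).withDensity (fun s => ENNReal.ofReal (f s)))
      (Iio (u : ℝ)) = ENNReal.ofReal (∫ s in (0 : ℝ)..min (u : ℝ) t₀, f s) := by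
    rw [withDensity_apply _ measurableSet_Iio, Measure.restrict_restrict measurableSet_Iio,
      intervalIntegral.integral_of_le hm.1,
      ofReal_integral_eq_lintegral_ofReal hi (ae_of_all _ hf0)]
    refine setLIntegral_congr ?_
    filter_upwards [compl_mem_ae_iff.2 (measure_singleton (u : ℝ)),
      compl_mem_ae_iff.2 (measure_singleton (0 : ℝ))] with s hs hs0
    refine propext ⟨fun h => ⟨lt_of_le_of_ne h.2.1 (Ne.symm hs0), le_min (le_of_lt h.1) h.2.2⟩,
      fun h => ⟨lt_of_le_of_ne (h.2.trans (min_le_left _ _)) hs, h.1.le,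
        h.2.trans (min_le_right _ _)⟩⟩
  rw [flowMeasure, Measure.smul_apply, Measure.add_apply, h1, Measure.dirac_apply' _
    measurableSet_Iio, smul_eq_mul, ENNReal.ofReal_mul hΘ, add_comm]
  congr 1
  rw [ENNReal.ofReal_add (by split_ifs <;> simp) (optimalPayment_nonneg_integral hf0 ht₀ u)]
  congr 1
  by_cases h : t₀ < u
  · rw [if_pos h, indicator_of_mem (mem_Iio.2 h)]; simp
  · rw [if_neg h, indicator_of_notMem (by simpa using h)]; simp

theorem isPaymentFunction_optimalPayment (hθ : 0 < θ) (hlam : 0 < lam)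
    (hf : IsBindingFlow w t₀ f) (hfm : Measurable f) (hf0 : ∀ s, 0 ≤ f s) (ht₀ : 0 < t₀) :
    IsPaymentFunction (optimalPayment θ lam t₀ f) where
  zero := by
    simp [optimalPayment, not_lt.2 ht₀.le, min_eq_left ht₀.le]
  mono := by
    intro a b hab
    have hab' : (a : ℝ) ≤ b := hab
    unfold optimalPayment
    refine mul_le_mul_of_nonneg_left (add_le_add ?_ ?_) (div_pos hθ hlam).le
    · by_cases h : t₀ < (a : ℝ)
      · rw [if_pos h, if_pos (h.trans_le hab')]
      · rw [if_neg h]; split_ifs <;> simp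
    · have ha : min (a : ℝ) t₀ ∈ Icc 0 t₀ := ⟨le_min a.coe_nonneg ht₀.le, min_le_right _ _⟩
      have hb : min (b : ℝ) t₀ ∈ Icc 0 t₀ := ⟨le_min b.coe_nonneg ht₀.le, min_le_right _ _⟩
      exact intervalIntegral.integral_mono_interval le_rfl ha.1 (min_le_min_right _ hab')
        (ae_of_all _ hf0) (intervalIntegrable_of_isBindingFlow hf ⟨le_rfl, ht₀.le⟩ hb)
  leftCont := by
    intro t
    unfold optimalPayment
    refine ContinuousWithinAt.mul continuousWithinAt_const (ContinuousWithinAt.add ?_ ?_)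
    · rcases lt_or_ge t₀ (t : ℝ) with h | h
      · refine ContinuousAt.continuousWithinAt ?_
        have hev : ∀ᶠ u : ℝ≥0 in 𝓝 t, t₀ < (u : ℝ) :=
          NNReal.continuous_coe.continuousAt.eventually (lt_mem_nhds h)
        refine (continuousAt_const (y := (1 : ℝ))).congr ?_
        filter_upwards [hev] with u hu
        rw [if_pos hu]
      · refine (continuousWithinAt_const (b := (0 : ℝ))).congr (fun u hu => ?_) ?_
        · rw [if_neg (not_lt.2 ((NNReal.coe_le_coe.2 hu).trans h))]
        · rw [if_neg (not_lt.2 h)]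
    · refine Continuous.continuousWithinAt ?_
      have hc : ContinuousOn (fun x => ∫ s in (0 : ℝ)..x, f s) (Icc 0 t₀) :=
        intervalIntegral.continuousOn_primitive_interval (by rw [uIcc_of_le ht₀.le]; exact hf.1)
          |>.mono (by rw [uIcc_of_le ht₀.le])
      exact hc.comp_continuous (f := fun u : ℝ≥0 => min (u : ℝ) t₀) (by fun_prop)
        fun u => ⟨le_min u.coe_nonneg ht₀.le, min_le_right _ _⟩
  regular := by
    have hΘ : 0 ≤ θ / lam := (div_pos hθ hlam).le
    refine ⟨fun s => indicator (Icc 0 t₀) (fun s => Real.toNNReal (θ / lam * f s)) s,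
      fun _ => Real.toNNReal t₀, fun n => if n = 0 then Real.toNNReal (θ / lam) else 0,
      Measurable.indicator (by fun_prop) measurableSet_Icc, fun t => ?_⟩
    have h := flowMeasure_Iio hΘ hf hf0 ht₀ t
    rw [optimalPayment, ← h, flowMeasure, Measure.smul_apply, Measure.add_apply,
      withDensity_apply _ measurableSet_Iio, Measure.restrict_restrict measurableSet_Iio,
      smul_eq_mul, mul_add]
    congr 1
    · have hcoe : ∀ s, ((indicator (Icc 0 t₀) (fun s => Real.toNNReal (θ / lam * f s)) s : ℝ≥0) :
          ℝ≥0∞) = indicator (Icc 0 t₀) (fun s => ENNReal.ofReal (θ / lam) * ENNReal.ofReal (f s)) s := by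
        intro s
        by_cases hs : s ∈ Icc 0 t₀
        · rw [indicator_of_mem hs, indicator_of_mem hs, ← ENNReal.ofReal_mul hΘ]; rfl
        · rw [indicator_of_notMem hs, indicator_of_notMem hs]; rfl
      simp only [hcoe]
      rw [setLIntegral_indicator measurableSet_Icc, ← lintegral_const_mul _ (by fun_prop)]
      refine setLIntegral_congr ?_
      filter_upwards [compl_mem_ae_iff.2 (measure_singleton (t : ℝ))] with s hs
      exact propext ⟨fun h => ⟨h.2, h.2.1, le_of_lt h.1⟩,
        fun h => ⟨lt_of_le_of_ne h.2.2 hs, h.1⟩⟩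
    · rw [tsum_eq_single 0 (fun n hn => by simp [hn]), Measure.dirac_apply' _ measurableSet_Iio]
      by_cases h : t₀ < t
      · rw [indicator_of_mem (mem_Iio.2 h), if_pos ((Real.toNNReal_lt_iff_lt_coe ht₀.le).2 h)]
        simp [ENNReal.ofReal]
      · rw [indicator_of_notMem (by simpa using h),
          if_neg (fun h' => h ((Real.toNNReal_lt_iff_lt_coe ht₀.le).1 h')), mul_zero]

/-- Both measures give `Iio u` the finite mass `T*(u)` for `u ≥ 0` and no mass for `u < 0`, which
determines them. -/
theorem paymentMeasure_optimalPayment (hθ : 0 < θ) (hlam : 0 < lam)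
    (hf : IsBindingFlow w t₀ f) (hfm : Measurable f) (hf0 : ∀ s, 0 ≤ f s) (ht₀ : 0 < t₀) :
    paymentMeasure (paymentSurvival expTime (optimalPayment θ lam t₀ f)) =
      flowMeasure (θ / lam) t₀ f := by
  have hΘ : 0 ≤ θ / lam := (div_pos hθ hlam).le
  have hT := isPaymentFunction_optimalPayment hθ hlam hf hfm hf0 ht₀
  set μ := paymentMeasure (paymentSurvival expTime (optimalPayment θ lam t₀ f))
  have hIio : ∀ b : ℝ, μ (Iio b) = flowMeasure (θ / lam) t₀ f (Iio b) ∧ μ (Iio b) ≠ ∞ := by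
    intro b
    rcases le_or_gt 0 b with hb | hb
    · lift b to ℝ≥0 using hb
      have h1 := hT.paymentMeasure_expTime_Iio b
      have h2 := flowMeasure_Iio hΘ hf hf0 ht₀ b
      exact ⟨h1.trans h2.symm, h1 ▸ ENNReal.ofReal_ne_top⟩
    · have h1 : μ (Iio b) = 0 := by
        rw [measure_eq_zero_iff_ae_notMem]
        filter_upwards [(isSurvival_paymentSurvival expTime
          (optimalPayment θ lam t₀ f)).ae_nonneg] with s hs
        exact not_lt.2 (hb.le.trans hs)
      have h2 : flowMeasure (θ / lam) t₀ f (Iio b) = 0 := by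
        rw [measure_eq_zero_iff_ae_notMem]
        filter_upwards [ae_flowMeasure ht₀] with s hs
        exact not_lt.2 (hb.le.trans hs.1)
      exact ⟨h1.trans h2.symm, h1 ▸ ENNReal.zero_ne_top⟩
  refine Measure.ext_of_Ico' _ _ (fun a b _ => ?_) fun a b hab => ?_
  · exact ne_top_of_le_ne_top (hIio b).2 (measure_mono Ico_subset_Iio_self)
  · have hIco : Ico a b = Iio b \ Iio a := by ext; simp
    rw [hIco, measure_sdiff (Iio_subset_Iio hab.le) measurableSet_Iio.nullMeasurableSet (hIio a).2,
      measure_sdiff (Iio_subset_Iio hab.le) measurableSet_Iio.nullMeasurableSet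
        ((hIio a).1 ▸ (hIio a).2), (hIio a).1, (hIio b).1]

end Optimal

end

end LootBox

end

/-! ### Strong duality and its equality case. -/

open LootBox in
theorem theorem3 (wp wm : ℝ → ℝ) (hwp : IsWeighting wp) (hwm : IsWeighting wm)
    (θ lam : ℝ) (hθ : 0 < θ) (hlam : 0 < lam) :
    -- the unique fixed point of the weighting function of losses
    ∃ p₁ ∈ Ioo (0 : ℝ) 1, wm p₁ = p₁ ∧ (∀ p ∈ Ioo (0 : ℝ) 1, wm p = p → p = p₁) ∧
    -- the unique function `g₀` in `L¹[0, -log p₁]`, in its version that is continuous for `t > 0`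
    -- (at `t = 0` its limit `wm'(1) - 1 > 0` may be `+∞`, so `0` never competes for `t₀`)
    ∃ g₀ : ℝ → ℝ, IsMultiplier wm (-Real.log p₁) g₀ ∧ ContinuousOn g₀ (Ioc 0 (-Real.log p₁)) ∧
      (∀ g, IsMultiplier wm (-Real.log p₁) g →
        g =ᵐ[volume.restrict (Icc 0 (-Real.log p₁))] g₀) ∧
    -- the first time at which `g₀` is not positive
    ∃ t₀ : ℝ, IsLeast {t | t ∈ Ioc 0 (-Real.log p₁) ∧ g₀ t ≤ 0} t₀ ∧
    -- the unique flow that makes dynamic individual rationality bind on `[0, t₀]`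
    ∃ f : ℝ → ℝ, IsBindingFlow wm t₀ f ∧
      (∀ f', IsBindingFlow wm t₀ f' → f' =ᵐ[volume.restrict (Icc 0 t₀)] f) ∧
    -- optimality of `(τ₀, T*)`
      IsOptimal wp wm θ lam expTime (optimalPayment θ lam t₀ f) ∧
    -- characterization of all optimal processes
      ∀ (ν : Measure ℝ≥0∞) (T : ℝ≥0 → ℝ), IsPricingProcess ν T →
        (IsOptimal wp wm θ lam ν T ↔
          ν {a | a < ∞} = 1 ∧
          ∀ y : ℝ≥0, ν {a | totalPayment T a ≤ y} =
            expTime {a | totalPayment (optimalPayment θ lam t₀ f) a ≤ y}) := by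
  obtain ⟨p, hp, hfix⟩ := hwm.exists_fixedPoint
  have hS : 0 < -Real.log p := neg_pos.2 (Real.log_neg hp.1 hp.2)
  have hexp : Real.exp (-(-Real.log p)) = p := by rw [neg_neg, Real.exp_log hp.1]
  obtain ⟨t₀, ht₀⟩ := hwm.exists_isLeast hS (by rw [hexp, hfix])
  have hcut : IsCutoff wm (-Real.log p) t₀ := ht₀
  -- This version of the flow is measurable and nonnegative everywhere, so `T*` is a payment
  -- function without changes on null sets.
  set f : ℝ → ℝ := fun s => renewal wm (-Real.log p) (t₀ - s)
  have hf : IsBindingFlow wm t₀ f := hwm.isBindingFlow_renewal hS hcut.le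
  have hfm : Measurable f := measurable_renewal.comp (by fun_prop)
  have hf0 : ∀ s, 0 ≤ f s := fun s => renewal_nonneg _
  set S := optimalPayment θ lam t₀ f
  have hpay : IsPaymentFunction S := isPaymentFunction_optimalPayment hθ hlam hf hfm hf0 hcut.pos
  have hproc : IsPricingProcess expTime S := ⟨isTimeLaw_expTime, hpay⟩
  have hmeas := paymentMeasure_optimalPayment hθ hlam hf hfm hf0 hcut.pos
  set Θ : ℝ≥0∞ := ENNReal.ofReal (θ / lam)
  have hΘtop : Θ ≠ ∞ := ENNReal.ofReal_ne_top
  have hload : ∀ t, 0 ≤ t → load wm (paymentMeasure (paymentSurvival expTime S)) t ≤ Θ := by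
    intro t ht
    rw [hmeas]
    rcases le_or_gt t t₀ with h | h
    · exact (hwm.load_flowMeasure hf hf0 ⟨ht, h⟩).le
    · rw [load_flowMeasure_of_lt hcut.pos h]
      exact zero_le
  have hdir : DIR wp wm θ lam expTime S := hpay.dir_of_load_le hwp hwm hlam expTime_lt_top hload
  have hprofit : profit expTime S = Θ * shadowMass wm (-Real.log p) t₀ := by
    rw [profit_eq, ← (isSurvival_paymentSurvival expTime S).lintegral_exp_neg, hmeas]
    exact hwm.lintegral_exp_neg_eq hS hcut (ae_flowMeasure hcut.pos)
      fun t ht => hwm.load_flowMeasure hf hf0 ht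
  have hbound : ∀ (ν : Measure ℝ≥0∞) (T : ℝ≥0 → ℝ), IsPricingProcess ν T →
      DIR wp wm θ lam ν T → profit ν T ≤ Θ * shadowMass wm (-Real.log p) t₀ := by
    intro ν T hνT hd
    have := hνT.1.prob
    rw [profit_eq, ← (isSurvival_paymentSurvival ν T).lintegral_exp_neg]
    exact hwm.lintegral_exp_neg_le hS hcut (isSurvival_paymentSurvival ν T).ae_nonneg
      fun t _ => hνT.2.load_le_of_dir hwp hwm hθ hlam hd t
  refine ⟨p, hp, hfix, fun q hq hq' => hwm.fixedPoint_unique hq hp hq' hfix,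
    multiplier wm (-Real.log p), hwm.isMultiplier_multiplier hS, hwm.continuousOn_multiplier hS,
    fun g hg => hwm.isMultiplier_unique hS hg (hwm.isMultiplier_multiplier hS), t₀, ht₀, f, hf,
    fun f' hf' => hwm.isBindingFlow_unique hcut.pos hf' hf,
    ⟨hproc, hdir, fun ν T h1 h2 => hprofit ▸ hbound ν T h1 h2⟩, fun ν T hνT => ?_⟩
  have := hνT.1.prob
  have hlaw : (∀ y : ℝ≥0, ν {a | totalPayment T a ≤ y} = expTime {a | totalPayment S a ≤ y}) ↔
      ∀ y : ℝ, 0 ≤ y → paymentSurvival ν T y = paymentSurvival expTime S y := by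
    have hcompl : ∀ (ν : Measure ℝ≥0∞) [IsProbabilityMeasure ν] (T : ℝ≥0 → ℝ),
        IsPaymentFunction T → ∀ y : ℝ≥0, ν {a | totalPayment T a ≤ y} =
          1 - ENNReal.ofReal (paymentSurvival ν T y) := by
      intro ν _ T hT y
      have hset : {a | totalPayment T a ≤ y} = {a | ENNReal.ofReal y < totalPayment T a}ᶜ := by
        ext a; simp
      rw [hset, prob_compl_eq_one_sub (hT.measurableSet_lt_totalPayment _), paymentSurvival,
        ofReal_measureReal]
    refine ⟨fun h y hy => ?_, fun h y => ?_⟩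
    · lift y to ℝ≥0 using hy
      have h1 := h y
      rw [hcompl ν T hνT.2, hcompl expTime S hpay,
        ENNReal.sub_right_inj ENNReal.one_ne_top
          (by simpa using (isSurvival_paymentSurvival ν T).le_one y)
          (by simpa using (isSurvival_paymentSurvival expTime S).le_one y),
        ENNReal.ofReal_eq_ofReal_iff ((isSurvival_paymentSurvival ν T).nonneg y)
          ((isSurvival_paymentSurvival expTime S).nonneg y)] at h1
      exact h1
    · rw [hcompl ν T hνT.2, hcompl expTime S hpay, h y y.coe_nonneg]
  rw [hlaw]
  constructor
  · rintro ⟨-, hd, hmax⟩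
    have hl : ∀ t, 0 ≤ t → load wm (paymentMeasure (paymentSurvival ν T)) t ≤ Θ :=
      fun t _ => hνT.2.load_le_of_dir hwp hwm hθ hlam hd t
    have hpr : profit ν T = Θ * shadowMass wm (-Real.log p) t₀ :=
      le_antisymm (hbound ν T hνT hd) (hprofit ▸ hmax expTime S hproc hdir)
    rw [profit_eq] at hpr hprofit
    refine ⟨?_, fun y hy => (isSurvival_paymentSurvival ν T).eq_of_optimal
      (isSurvival_paymentSurvival expTime S) hwm hS hcut hΘtop hl hload hpr hprofit hy⟩
    by_contra hne
    have hlt := hνT.2.load_zero_lt hwp hwm hθ hlam hd hne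
    rw [← (isSurvival_paymentSurvival ν T).lintegral_exp_neg] at hpr
    exact hlt.ne (hwm.slackness hS hΘtop hcut (isSurvival_paymentSurvival ν T).ae_nonneg hl hpr).2.1
  · rintro ⟨hfin, hG⟩
    -- For almost surely finite `τ`, the loads and the profit depend on the process only through its
    -- survival function at nonnegative levels, so feasibility and optimality transfer from `T*`.
    have hGload : ∀ t, load wm (paymentMeasure (paymentSurvival ν T)) t =
        load wm (paymentMeasure (paymentSurvival expTime S)) t := by
      intro t
      have hms : ∀ ν : Measure ℝ≥0∞, ∀ T : ℝ≥0 → ℝ, IsProbabilityMeasure ν →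
          MeasurableSet {y | 0 < y ∧ paymentSurvival ν T y ≤ Real.exp (-t)} := fun ν T _ =>
        (measurableSet_lt measurable_const measurable_id).inter
          (measurableSet_le (isSurvival_paymentSurvival ν T).measurable measurable_const)
      rw [(isSurvival_paymentSurvival ν T).load_paymentMeasure hwm,
        (isSurvival_paymentSurvival expTime S).load_paymentMeasure hwm]
      have hset : {y | 0 < y ∧ paymentSurvival ν T y ≤ Real.exp (-t)} =
          {y | 0 < y ∧ paymentSurvival expTime S y ≤ Real.exp (-t)} := by
        ext y
        exact and_congr_right fun hy => by rw [hG y hy.le]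
      rw [hset]
      exact setLIntegral_congr_fun (hms expTime S inferInstance) fun y hy => by rw [hG y hy.1.le]
    have hd : DIR wp wm θ lam ν T :=
      hνT.2.dir_of_load_le hwp hwm hlam hfin fun t ht => (hGload t).le.trans (hload t ht)
    have hpr : profit ν T = profit expTime S := by
      rw [profit_eq, profit_eq]
      exact setLIntegral_congr_fun measurableSet_Ioi fun y hy => by rw [hG y (le_of_lt hy)]
    exact ⟨hνT, hd, fun ν' T' h1 h2 => by rw [hpr, hprofit]; exact hbound ν' T' h1 h2⟩
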